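/- Setting. A single buyer has a value $v\ge 0$ drawn from an unknown probability distribution (prior) $D$. A mechanism consists of an allocation function $x(b)\in[0,1]$ and a payment function $p(b)$ of the bid $b\ge 0$, and is dominant strategy incentive compatible and individually rational; its revenue on $D$ is $\mathbf E_{v\sim D}[p(v)]$, and $\mathrm{OPT}(D)$ is the supremum of the revenues of all such mechanisms. For $q\in(0,1]$ let $v_D(q)=\max\{v\ge 0:\Pr_{x\sim D}[x\ge v]\ge q\}$ be the value at quantile $q$. $D$ is regular if its revenue curve $q\mapsto q\,v_D(q)$ is concave on $(0,1]$ (for a distribution with density $f$ and cdf $F$: the virtual value $v-\frac{1-F(v)}{f(v)}$ is nondecreasing); $D$ has monotone hazard rate (MHR) if $v\mapsto-\log\Pr_{x\sim D}[x\ge v]$ is convex where it is finite (for a distribution with density: $\frac{1-F}{f}$ is nonincreasing); $D$ is $[a,b]$-bounded if it is supported in $[a,b]$. For $0<\Delta<1$, a learning algorithm with $m$ targeted samples of targeting power $\Delta$ adaptively chooses $m$ quantile intervals $[a,b]\subseteq[0,1]$ of width $b-a\ge\Delta$, each possibly depending on the earlier answers; to each it receives an independent answer $v_D(q)$ with $q$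 uniform on $[a,b]$; it then outputs a mechanism. It does not know $D$. Theorem. There are absolute constants $C,k$ such that for all $\epsilon,\Delta,\delta\in(0,1)$, and all $H\ge 1$ in item 3, the following algorithms exist. 1. An algorithm that for every regular $D$ outputs, with probability at least $1-\delta$, a mechanism of revenue at least $(1-\epsilon)\,\mathrm{OPT}(D)$, with at most $C\,(1+\log\frac1\epsilon+\log\frac1\delta)^k\max\{1,\min\{\Delta^2\epsilon^{-4},\Delta\epsilon^{-3}\}\}$ targeted samples. 2. An algorithm that does the same for every MHR $D$, with at most $C\,(1+\log\frac1\epsilon+\log\frac1\delta)^k\max\{1,\Delta^2\epsilon^{-2}\}$ targeted samples. 3. An algorithm that does the same for every $[1,H]$-bounded $D$, with at most $C\,(1+\log H+\log\frac1\epsilon+\log\frac1\delta)^k\max\{H^{1/2}\epsilon^{-1},\Delta H\epsilon^{-2}\}$ targeted samples. 4. An algorithm that for every $[0,1]$-bounded $D$ outputs, with probability at least $1-\delta$, a mechanism of revenue at least $\mathrm{OPT}(D)-\epsilon$, with at most $C\,(1+\log\frac1\epsilon+\log\frac1\delta)^k\max\{\epsilon^{-1},\Delta\epsilon^{-2}\}$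 targeted samples. -/

import Mathlib

open MeasureTheory Set

noncomputable section

/-- A direct-revelation mechanism for one item and one buyer that is dominant strategy incentive
compatible and individually rational: `alloc b` is the probability of receiving the item and
`pay b` the expected payment when the bid is `b ≥ 0`. -/
structure Mechanism where
  alloc : ℝ → ℝ
  pay : ℝ → ℝ
  alloc_nonneg : ∀ b, 0 ≤ b → 0 ≤ alloc b
  alloc_le_one : ∀ b, 0 ≤ b → alloc b ≤ 1
  dsic : ∀ v b, 0 ≤ v → 0 ≤ b → v * alloc b - pay b ≤ v * alloc v - pay v
  ir : ∀ v, 0 ≤ v → 0 ≤ v * alloc v - pay v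

/-- Expected revenue of a mechanism when the (truthfully reported) value has law `D`. -/
def Mechanism.revenue (M : Mechanism) (D : Measure ℝ) : ℝ := ∫ v, M.pay v ∂D

/-- The optimal revenue: the supremum of the revenues of all DSIC and IR mechanisms. -/
def optRevenue (D : Measure ℝ) : ℝ := ⨆ M : Mechanism, M.revenue D

/-- `D` is a prior: a probability distribution of a nonnegative value. -/
structure IsPrior (D : Measure ℝ) : Prop where
  prob : IsProbabilityMeasure D
  nonneg : D (Iio 0) = 0

/-- The quantile of a value `v` with respect to `D`: the probability that a value drawn from `D`
is at least `v`. -/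
def quantileOf (D : Measure ℝ) (v : ℝ) : ℝ := D.real (Ici v)

/-- The value at quantile `q ∈ (0, 1]`: the largest value whose quantile is at least `q`. If `q` is
uniform on `(0, 1]`, then `valueAt D q` has law `D`. -/
def valueAt (D : Measure ℝ) (q : ℝ) : ℝ := sSup {v : ℝ | 0 ≤ v ∧ q ≤ quantileOf D v}

/-- `D` is regular: its revenue curve `q ↦ q * v(q)` in quantile space is concave. Its slope at `q`
is the virtual value of `v(q)`; for a distribution with a density `f` and cdf `F` the condition is
that `v - (1 - F v) / f v` is nondecreasing. -/
def IsRegularPrior (D : Measure ℝ) : Prop :=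
  ConcaveOn ℝ (Ioc 0 1) fun q => q * valueAt D q

/-- `D` has monotone hazard rate: its cumulative hazard function `-log (P[V ≥ v])` is convex where
it is finite. For a distribution with a density `f` and cdf `F` the condition is that
`(1 - F v) / f v` is nonincreasing. -/
def IsMHRPrior (D : Measure ℝ) : Prop :=
  ConvexOn ℝ {v : ℝ | 0 < quantileOf D v} fun v => -Real.log (quantileOf D v)

def regularPriors : Set (Measure ℝ) := {D | IsPrior D ∧ IsRegularPrior D}

def mhrPriors : Set (Measure ℝ) := {D | IsPrior D ∧ IsMHRPrior D}

/-- The priors supported in `[a, b]`. -/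
def boundedPriors (a b : ℝ) : Set (Measure ℝ) := {D | IsPrior D ∧ D (Icc a b)ᶜ = 0}

/-- An adaptive algorithm that draws `m` targeted samples with targeting power `Δ` and then outputs
a mechanism. The `i`-th query is the quantile interval `[lo i h, hi i h] ⊆ [0, 1]` of width at
least `Δ`, where `h` lists the answers to the earlier queries; the output is a function of all
answers. -/
structure TargetedAlgorithm (Δ : ℝ) (m : ℕ) where
  lo : (i : Fin m) → (Fin i → ℝ) → ℝ
  hi : (i : Fin m) → (Fin i → ℝ) → ℝ
  lo_nonneg : ∀ i h, 0 ≤ lo i h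
  hi_le_one : ∀ i h, hi i h ≤ 1
  width : ∀ i h, Δ ≤ hi i h - lo i h
  output : (Fin m → ℝ) → Mechanism
  measurable_lo : ∀ i, Measurable (lo i)
  measurable_hi : ∀ i, Measurable (hi i)
  measurable_alloc : Measurable fun z : (Fin m → ℝ) × ℝ => (output z.1).alloc z.2
  measurable_pay : Measurable fun z : (Fin m → ℝ) × ℝ => (output z.1).pay z.2

/-- The value of `D` at the quantile `a + t (b - a)`. When `t` is uniform on `[0, 1]`, this is a
targeted sample from the quantile interval `[a, b]`, that is, a sample from `D` conditioned on
having its quantile in `[a, b]` (ties at atoms of `D` being broken uniformly at random). -/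
def targetedSample (D : Measure ℝ) (a b : ℝ) (t : unitInterval) : ℝ :=
  valueAt D (a + (t : ℝ) * (b - a))

/-- The answers that the algorithm receives when the prior is `D` and the `i`-th targeted sample
uses the random seed `u i`. -/
def TargetedAlgorithm.answers {Δ : ℝ} {m : ℕ} (A : TargetedAlgorithm Δ m) (D : Measure ℝ)
    (u : Fin m → unitInterval) (i : Fin m) : ℝ :=
  let h : Fin i → ℝ := fun j => A.answers D u ⟨j, j.isLt.trans i.isLt⟩
  targetedSample D (A.lo i h) (A.hi i h) (u i)
termination_by i.val
decreasing_by exact j.isLt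

/-- The probability, over `m` independent uniform seeds, that the mechanism learned by `A` has
expected revenue at least `r` on the prior `D`. -/
def TargetedAlgorithm.successProb {Δ : ℝ} {m : ℕ} (A : TargetedAlgorithm Δ m) (D : Measure ℝ)
    (r : ℝ) : ℝ :=
  (volume : Measure (Fin m → unitInterval)).real
    {u | r ≤ (A.output (A.answers D u)).revenue D}

/-- One algorithm with `m` targeted samples of power `Δ` learns, for every prior `D` in the family
and with probability at least `1 - δ`, a mechanism with expected revenue at least `target D`. -/
def Learnable (family : Set (Measure ℝ)) (target : Measure ℝ → ℝ) (Δ δ : ℝ) (m : ℕ) : Prop :=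
  ∃ A : TargetedAlgorithm Δ m, ∀ D ∈ family, 1 - δ ≤ A.successProb D (target D)

end

/-!
Posted prices are optimal: a payment rule is dominated by the mixture of posted prices that its
allocation rule describes (`Mechanism.revenue_le`). So the optimal revenue is at most the supremum
of the revenue curve `R q = q * v q` (`optRevenue_le`), and it is enough to find a price whose
revenue competes with `R q` for every quantile `q`.

All randomness enters through one event about the seeds alone, so that adaptivity costs nothing: in
each block of samples the empirical distribution of the seeds is uniformly close to the uniform one,
with relative precision `α` above the threshold `σ`. By a Chernoff bound and a union bound over a
grid, about `log (1 / δ) / (α ^ 2 * σ)` samples are enough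
(`volume_real_exists_not_blockGood_le`). Everything after that is deterministic.

*Bounded priors.* The interval `[0, 1]` of quantiles is cut into windows of width at least `Δ`, and
each gets a block of its own. The weighted fraction of the answers that are at least `p` is then the
empirical distribution function at the true quantile of `p`, hence close to that quantile, and the
answer of largest estimated revenue is nearly optimal (`bestPrice_revenue`). If `Δ` is smaller than
`ε`, respectively `ε / √H`, it may be replaced by that number without changing the bound.

*Regular and MHR priors.* The revenue curve is concave, so its peak over `[c, 1]` can be found by a
ternary search with logarithmically many queries of relative precision `κ`
(`SearchInvariant.step`). A wrong comparison does no harm: if two of the compared points earn nearly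
the same, then concavity bounds the curve on the dropped side by about the value at the nearer
point, and the best price seen so far is kept. The value at `x` is estimated by an order statistic
of samples from the window `[x - w, x]`, or `[0, w]` if `x < w`. It takes about
`(w / c) ^ 2 / κ ^ 2` samples if `w ≤ c`, and `(w / c) / κ ^ 2` if `c ≤ w`, where the multiplicative
form of the Chernoff bound is needed; this is the minimum in the bound for regular priors, for which
`c` and `κ` are of order `ε`. MHR priors are regular (`IsMHRPrior.isRegularPrior`), and quantiles
below `exp (-1)` do not increase their revenue (`IsMHRPrior.revenue_le_of_lt`), so `c` can be a
constant.
-/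

/-! ### Quantiles and values -/

lemma quantileOf_antitone {D : Measure ℝ} [IsProbabilityMeasure D] :
    Antitone (quantileOf D) := fun _ _ h => measureReal_mono (Ici_subset_Ici.2 h)

lemma quantileOf_le_one {D : Measure ℝ} [IsProbabilityMeasure D] (v : ℝ) :
    quantileOf D v ≤ 1 := measureReal_le_one

lemma quantileOf_nonneg {D : Measure ℝ} (v : ℝ) : 0 ≤ quantileOf D v := measureReal_nonneg

lemma IsPrior.quantileOf_zero {D : Measure ℝ} (hD : IsPrior D) : quantileOf D 0 = 1 := by
  have := hD.prob
  have h : D (Ici 0)ᶜ = 0 := by rw [compl_Ici]; exact hD.nonneg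
  have := (prob_compl_eq_zero_iff (μ := D) measurableSet_Ici).1 h
  simp [quantileOf, Measure.real, this]

lemma tendsto_quantileOf_atTop {D : Measure ℝ} [IsProbabilityMeasure D] :
    Filter.Tendsto (quantileOf D) Filter.atTop (nhds 0) := by
  have h : Filter.Tendsto (fun v : ℝ => D (Ici v)) Filter.atTop (nhds (D (⋂ v : ℝ, Ici v))) :=
    tendsto_measure_iInter_atTop (fun _ => measurableSet_Ici.nullMeasurableSet)
      (fun _ _ h => Ici_subset_Ici.2 h) ⟨0, measure_ne_top _ _⟩
  have h0 : (⋂ v : ℝ, Ici v) = ∅ := by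
    ext x
    simpa using ⟨x + 1, by linarith⟩
  rw [h0, measure_empty] at h
  exact (ENNReal.tendsto_toReal ENNReal.zero_ne_top).comp h

lemma bddAbove_setOf_le_quantileOf {D : Measure ℝ} [IsProbabilityMeasure D] {q : ℝ} (hq : 0 < q) :
    BddAbove {v : ℝ | 0 ≤ v ∧ q ≤ quantileOf D v} := by
  obtain ⟨B, hB⟩ := (tendsto_quantileOf_atTop (D := D)).eventually (gt_mem_nhds hq) |>.exists
  refine ⟨B, fun v hv => ?_⟩
  by_contra! h
  exact absurd (hv.2.trans (quantileOf_antitone h.le)) (not_le.2 hB)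

/-- Tail probabilities `P[V ≥ v]` are left-continuous in `v`. -/
lemma le_quantileOf_of_forall_lt {D : Measure ℝ} [IsProbabilityMeasure D] {q v : ℝ}
    (h : ∀ w < v, q ≤ quantileOf D w) : q ≤ quantileOf D v := by
  have hI : Ici v = ⋂ n : ℕ, Ici (v - 1 / ((n : ℝ) + 1)) := by
    ext x
    simp only [mem_Ici, mem_iInter]
    constructor
    · intro hx n
      have : 0 < 1 / ((n : ℝ) + 1) := by positivity
      linarith
    · intro hx
      refine le_of_forall_pos_le_add fun η hη => ?_
      obtain ⟨n, hn⟩ := exists_nat_one_div_lt hη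
      linarith [hx n]
  have ht : Filter.Tendsto (fun n : ℕ => D (Ici (v - 1 / ((n : ℝ) + 1)))) Filter.atTop
      (nhds (D (Ici v))) := by
    rw [hI]
    refine tendsto_measure_iInter_atTop (fun _ => measurableSet_Ici.nullMeasurableSet)
      (fun a b hab => Ici_subset_Ici.2 ?_) ⟨0, measure_ne_top _ _⟩
    have : 1 / ((b : ℝ) + 1) ≤ 1 / ((a : ℝ) + 1) := by gcongr
    linarith
  have ht' := (ENNReal.tendsto_toReal (measure_ne_top D (Ici v))).comp ht
  refine ge_of_tendsto' ht' fun n => h _ ?_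
  have : 0 < 1 / ((n : ℝ) + 1) := by positivity
  linarith

lemma valueAt_nonneg {D : Measure ℝ} (q : ℝ) : 0 ≤ valueAt D q :=
  Real.sSup_nonneg fun _ hv => hv.1

/-- The supremum that defines `valueAt` is attained. -/
lemma IsPrior.le_quantileOf_valueAt {D : Measure ℝ} (hD : IsPrior D) {q : ℝ} (hq : q ≤ 1) :
    q ≤ quantileOf D (valueAt D q) := by
  have := hD.prob
  rcases le_or_gt q 0 with h0 | h0
  · exact h0.trans (quantileOf_nonneg _)
  refine le_quantileOf_of_forall_lt fun w hw => ?_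
  obtain ⟨v, hv, hwv⟩ := exists_lt_of_lt_csSup
    (s := {v : ℝ | 0 ≤ v ∧ q ≤ quantileOf D v}) ⟨0, le_rfl, by rwa [hD.quantileOf_zero]⟩ hw
  exact hv.2.trans (quantileOf_antitone hwv.le)

/-- The Galois connection between values and quantiles. -/
lemma IsPrior.le_valueAt_iff {D : Measure ℝ} (hD : IsPrior D) {q v : ℝ} (h0 : 0 < q) (h1 : q ≤ 1)
    (hv : 0 ≤ v) : v ≤ valueAt D q ↔ q ≤ quantileOf D v := by
  have := hD.prob
  exact ⟨fun h => (hD.le_quantileOf_valueAt h1).trans (quantileOf_antitone h),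
    fun h => le_csSup (bddAbove_setOf_le_quantileOf h0) ⟨hv, h⟩⟩

lemma IsPrior.valueAt_le_valueAt {D : Measure ℝ} (hD : IsPrior D) {p q : ℝ} (h0 : 0 < p)
    (hpq : p ≤ q) (h1 : q ≤ 1) : valueAt D q ≤ valueAt D p :=
  (hD.le_valueAt_iff h0 (hpq.trans h1) (valueAt_nonneg q)).2
    (hpq.trans (hD.le_quantileOf_valueAt h1))

/-! ### Posted prices are optimal mechanisms -/

/-- The mechanism that offers the item at the price `max p 0`. -/
noncomputable def postedPrice (p : ℝ) : Mechanism where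
  alloc b := if max p 0 ≤ b then 1 else 0
  pay b := if max p 0 ≤ b then max p 0 else 0
  alloc_nonneg b _ := by split_ifs <;> norm_num
  alloc_le_one b _ := by split_ifs <;> norm_num
  dsic v b _ _ := by split_ifs <;> linarith
  ir v _ := by split_ifs <;> linarith

lemma revenue_postedPrice {D : Measure ℝ} {p : ℝ} (hp : 0 ≤ p) :
    (postedPrice p).revenue D = p * quantileOf D p := by
  have : (fun v => (postedPrice p).pay v) = (Ici p).indicator fun _ => p := by
    ext v
    simp [postedPrice, indicator, max_eq_left hp]
  rw [Mechanism.revenue, this, integral_indicator measurableSet_Ici, setIntegral_const]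
  simp [quantileOf, mul_comm]

lemma Mechanism.alloc_mono (M : Mechanism) {v w : ℝ} (hv : 0 ≤ v) (hvw : v ≤ w) :
    M.alloc v ≤ M.alloc w := by
  rcases hvw.eq_or_lt with rfl | h
  · rfl
  have h1 := M.dsic v w hv (hv.trans hvw)
  have h2 := M.dsic w v (hv.trans hvw) hv
  nlinarith

lemma Mechanism.pay_mono (M : Mechanism) {v w : ℝ} (hv : 0 ≤ v) (hvw : v ≤ w) :
    M.pay v ≤ M.pay w := by
  have h1 := M.dsic v w hv (hv.trans hvw)
  have h2 := mul_le_mul_of_nonneg_left (M.alloc_mono hv hvw) hv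
  linarith

/-- A payment rule is dominated by a mixture of posted prices on the grid of mesh `η`: the price
`j * η` is offered with the probability by which the allocation grows from `j * η` to
`(j + 1) * η`. -/
lemma Mechanism.pay_le_sum (M : Mechanism) {η v : ℝ} (hη : 0 < η) (n : ℕ) (hv : 0 ≤ v)
    (hn : v ≤ n * η) :
    M.pay v ≤ η + ∑ j ∈ Finset.range n,
      (M.alloc ((j + 1 : ℕ) * η) - M.alloc (j * η)) * if j * η ≤ v then j * η else 0 := by
  obtain ⟨k, hk⟩ : ∃ k : ℕ, k = ⌊v / η⌋₊ := ⟨_, rfl⟩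
  have hkv : k * η ≤ v := by
    rw [← le_div_iff₀ hη, hk]
    exact Nat.floor_le (by positivity)
  have hvk : v ≤ (k + 1 : ℕ) * η := by
    rw [← div_le_iff₀ hη, hk]
    push_cast
    exact (Nat.lt_floor_add_one _).le
  have key : ∀ i : ℕ, M.pay (i * η) ≤ η * (M.alloc (i * η) - M.alloc 0) +
      ∑ j ∈ Finset.range i, (M.alloc ((j + 1 : ℕ) * η) - M.alloc (j * η)) * (j * η) := by
    intro i
    induction i with
    | zero => simpa using M.ir 0 le_rfl
    | succ i ih =>
      rw [Finset.sum_range_succ]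
      have := M.dsic ((i + 1 : ℕ) * η) (i * η) (by positivity) (by positivity)
      push_cast at this ih ⊢
      linarith
  have hterm : ∀ j : ℕ, 0 ≤ (M.alloc ((j + 1 : ℕ) * η) - M.alloc (j * η)) := fun j =>
    sub_nonneg.2 (M.alloc_mono (by positivity) (by gcongr; simp))
  have hle : ∀ i : ℕ, η * (M.alloc (i * η) - M.alloc 0) ≤ η := fun i => by
    have h1 := M.alloc_le_one (i * η) (by positivity)
    have h0 := M.alloc_nonneg 0 le_rfl
    nlinarith
  have hsum : ∀ i : ℕ, i ≤ k + 1 → i ≤ n → ∑ j ∈ Finset.range i,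
      (M.alloc ((j + 1 : ℕ) * η) - M.alloc (j * η)) * (j * η) ≤ ∑ j ∈ Finset.range n,
      (M.alloc ((j + 1 : ℕ) * η) - M.alloc (j * η)) * if j * η ≤ v then j * η else 0 := by
    intro i hik hin
    calc _ = ∑ j ∈ Finset.range i, (M.alloc ((j + 1 : ℕ) * η) - M.alloc (j * η)) *
          if j * η ≤ v then j * η else 0 := by
          refine Finset.sum_congr rfl fun j hj => ?_
          rw [if_pos]
          refine le_trans ?_ hkv
          gcongr
          have := Finset.mem_range.1 hj
          omega
      _ ≤ _ := Finset.sum_le_sum_of_subset_of_nonneg (by simpa using hin) fun j _ _ =>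
          mul_nonneg (hterm j) (by split_ifs <;> positivity)
  rcases le_total n (k + 1) with h | h
  · linarith [M.pay_mono hv hn, key n, hle n, hsum n h le_rfl]
  · linarith [M.pay_mono hv hvk, key (k + 1), hle (k + 1), hsum (k + 1) le_rfl h]

/-- No mechanism earns more than a bound on the revenue of all posted prices. -/
lemma Mechanism.revenue_le (M : Mechanism) {D : Measure ℝ} (hD : IsPrior D) {B : ℝ}
    (hB : ∀ v, 0 ≤ v → v * quantileOf D v ≤ B) : M.revenue D ≤ B := by
  have := hD.prob
  have hB0 : 0 ≤ B := by simpa using hB 0 le_rfl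
  have hae : ∀ᵐ v ∂D, 0 ≤ v := by
    rw [ae_iff]
    simpa [Iio] using hD.nonneg
  refine le_of_forall_pos_le_add fun η hη => ?_
  set dx : ℕ → ℝ := fun j => M.alloc ((j + 1 : ℕ) * η) - M.alloc (j * η) with hdx
  have hdx0 : ∀ j, 0 ≤ dx j := fun j =>
    sub_nonneg.2 (M.alloc_mono (by positivity) (by gcongr; simp))
  have hdx1 : ∑' j, ENNReal.ofReal (dx j) ≤ 1 := by
    rw [ENNReal.tsum_eq_iSup_nat]
    refine iSup_le fun n => ?_
    rw [← ENNReal.ofReal_sum_of_nonneg fun j _ => hdx0 j, Finset.sum_range_sub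
      (fun j : ℕ => M.alloc (j * η)), ← ENNReal.ofReal_one]
    refine ENNReal.ofReal_le_ofReal ?_
    have h0 := M.alloc_nonneg ((0 : ℕ) * η) (by simp)
    linarith [M.alloc_le_one (n * η) (by positivity)]
  have hpt : ∀ v : ℝ, 0 ≤ v → ENNReal.ofReal (M.pay v) ≤ ENNReal.ofReal η +
      ∑' j : ℕ, (Ici (j * η)).indicator (fun _ => ENNReal.ofReal (dx j * (j * η))) v := by
    intro v hv
    obtain ⟨n, hn⟩ := exists_nat_ge (v / η)
    rw [div_le_iff₀ hη] at hn
    refine (ENNReal.ofReal_le_ofReal (M.pay_le_sum hη n hv hn)).trans ?_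
    have hnn : ∀ j ∈ Finset.range n, 0 ≤ dx j * if j * η ≤ v then j * η else 0 := fun j _ =>
      mul_nonneg (hdx0 j) (by split_ifs <;> positivity)
    rw [ENNReal.ofReal_add hη.le (Finset.sum_nonneg hnn), ENNReal.ofReal_sum_of_nonneg hnn]
    gcongr
    refine le_trans (le_of_eq ?_) (ENNReal.sum_le_tsum (Finset.range n))
    refine Finset.sum_congr rfl fun j _ => ?_
    by_cases h : j * η ≤ v <;> simp [indicator, h]
  have hmain : ∫⁻ v, ENNReal.ofReal (M.pay v) ∂D ≤ ENNReal.ofReal (η + B) := by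
    calc _ ≤ ∫⁻ v, ENNReal.ofReal η +
          ∑' j : ℕ, (Ici (j * η)).indicator (fun _ => ENNReal.ofReal (dx j * (j * η))) v ∂D :=
          lintegral_mono_ae (hae.mono hpt)
      _ = ENNReal.ofReal η + ∑' j : ℕ, ENNReal.ofReal (dx j * (j * η)) * D (Ici (j * η)) := by
          rw [lintegral_add_left measurable_const, lintegral_const, measure_univ, mul_one,
            lintegral_tsum fun j => (measurable_const.indicator measurableSet_Ici).aemeasurable]
          simp_rw [lintegral_indicator_const measurableSet_Ici]
      _ ≤ ENNReal.ofReal η + ∑' j : ℕ, ENNReal.ofReal (dx j) * ENNReal.ofReal B := by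
          refine add_le_add_right (ENNReal.tsum_le_tsum fun j => ?_) _
          rw [ENNReal.ofReal_mul (hdx0 j), mul_assoc, ← ofReal_measureReal,
            ← ENNReal.ofReal_mul (by positivity)]
          gcongr
          exact hB (j * η) (by positivity)
      _ ≤ ENNReal.ofReal η + 1 * ENNReal.ofReal B := by
          rw [ENNReal.tsum_mul_right]
          gcongr
      _ = ENNReal.ofReal (η + B) := by rw [one_mul, ENNReal.ofReal_add hη.le hB0]
  rw [Mechanism.revenue]
  by_cases hint : Integrable (fun v => M.pay v) D
  · rw [integral_eq_lintegral_pos_part_sub_lintegral_neg_part hint]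
    have := ENNReal.toReal_mono ENNReal.ofReal_ne_top hmain
    rw [ENNReal.toReal_ofReal (by positivity)] at this
    linarith [ENNReal.toReal_nonneg (a := ∫⁻ v, ENNReal.ofReal (-M.pay v) ∂D)]
  · rw [integral_undef hint]
    positivity

/-- The optimal revenue is at most the supremum of the revenue curve. -/
lemma optRevenue_le {D : Measure ℝ} (hD : IsPrior D) {B : ℝ}
    (hB : ∀ q, 0 < q → q ≤ 1 → q * valueAt D q ≤ B) : optRevenue D ≤ B := by
  have := hD.prob
  have : Nonempty Mechanism := ⟨postedPrice 0⟩
  refine ciSup_le fun M => M.revenue_le hD fun v hv => ?_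
  rcases (quantileOf_nonneg (D := D) v).eq_or_lt with h | h
  · rw [← h, mul_zero]
    exact (mul_nonneg zero_le_one (valueAt_nonneg 1)).trans (hB 1 one_pos le_rfl)
  · rw [mul_comm]
    refine le_trans ?_ (hB _ h (quantileOf_le_one v))
    gcongr
    exact (hD.le_valueAt_iff h (quantileOf_le_one v) hv).2 le_rfl

lemma mul_optRevenue_le {D : Measure ℝ} (hD : IsPrior D) {a B : ℝ} (ha : 0 < a)
    (hB : ∀ q, 0 < q → q ≤ 1 → a * (q * valueAt D q) ≤ B) : a * optRevenue D ≤ B := by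
  rw [← le_div_iff₀' ha]
  exact optRevenue_le hD fun q h0 h1 => (le_div_iff₀' ha).2 (hB q h0 h1)

lemma measurable_postedPrice {α : Type*} [MeasurableSpace α] {f : α → ℝ} (hf : Measurable f) :
    (Measurable fun z : α × ℝ => (postedPrice (f z.1)).alloc z.2) ∧
      Measurable fun z : α × ℝ => (postedPrice (f z.1)).pay z.2 := by
  have hm : Measurable fun z : α × ℝ => max (f z.1) 0 :=
    (hf.comp measurable_fst).max measurable_const
  have hs : MeasurableSet {z : α × ℝ | max (f z.1) 0 ≤ z.2} := measurableSet_le hm measurable_snd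
  exact ⟨Measurable.ite hs measurable_const measurable_const, Measurable.ite hs hm measurable_const⟩

/-! ### Revenue curves of regular and of MHR priors -/

/-- Concavity bounds how fast the revenue curve of a regular prior falls to the right. -/
lemma IsRegularPrior.le_revenue_of_le {D : Measure ℝ} (hreg : IsRegularPrior D) {p q : ℝ}
    (hp : 0 < p) (hpq : p ≤ q) (hq : q ≤ 1) :
    (1 - q) * (p * valueAt D p) ≤ q * valueAt D q := by
  rcases hpq.eq_or_lt with rfl | hlt
  · nlinarith [mul_nonneg hp.le (valueAt_nonneg (D := D) p)]
  have h1 : 0 < 1 - p := by linarith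
  have ha : 0 ≤ (1 - q) / (1 - p) := div_nonneg (by linarith) h1.le
  have hb : 0 ≤ (q - p) / (1 - p) := div_nonneg (by linarith) h1.le
  have := hreg.2 (x := p) (y := 1) ⟨hp, hpq.trans hq⟩ ⟨one_pos, le_rfl⟩ ha hb
    (by field_simp; ring)
  have hq' : ((1 - q) / (1 - p)) • p + ((q - p) / (1 - p)) • (1 : ℝ) = q := by
    simp only [smul_eq_mul]
    field_simp
    ring
  simp only [hq'] at this
  simp only [smul_eq_mul] at this
  have hv := mul_nonneg hp.le (valueAt_nonneg (D := D) p)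
  have h2 : 0 ≤ (q - p) / (1 - p) * (1 * valueAt D 1) :=
    mul_nonneg (div_nonneg (by linarith) h1.le) (mul_nonneg zero_le_one (valueAt_nonneg 1))
  have h3 : 1 - q ≤ (1 - q) / (1 - p) := by
    rw [le_div_iff₀ h1]
    nlinarith
  nlinarith

/-- MHR priors are regular: with `q` the weighted mean of `q₁` and `q₂`, convexity of the hazard
puts the quantile of the corresponding mean of the values above `q`, by convexity of
`x * log x`. -/
lemma IsMHRPrior.isRegularPrior {D : Measure ℝ} (hD : IsPrior D) (h : IsMHRPrior D) :
    IsRegularPrior D := by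
  refine ⟨convex_Ioc 0 1, ?_⟩
  intro q₁ h₁ q₂ h₂ a b ha hb hab
  simp only [smul_eq_mul]
  set q := a * q₁ + b * q₂ with hq
  have hqI : q ∈ Ioc (0 : ℝ) 1 := (convex_Ioc (0 : ℝ) 1) h₁ h₂ ha hb hab
  have hq0 : q ≠ 0 := hqI.1.ne'
  have hπ : a * q₁ / q + b * q₂ / q = 1 := by
    rw [← add_div, ← hq, div_self hq0]
  have hπ1 : 0 ≤ a * q₁ / q := div_nonneg (mul_nonneg ha h₁.1.le) hqI.1.le
  have hπ2 : 0 ≤ b * q₂ / q := div_nonneg (mul_nonneg hb h₂.1.le) hqI.1.le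
  have hv₁ := hD.le_quantileOf_valueAt h₁.2
  have hv₂ := hD.le_quantileOf_valueAt h₂.2
  have hpos₁ := h₁.1.trans_le hv₁
  have hpos₂ := h₂.1.trans_le hv₂
  have hconv := h.2 (x := valueAt D q₁) (y := valueAt D q₂) hpos₁ hpos₂ hπ1 hπ2 hπ
  have hmem := h.1 (x := valueAt D q₁) (y := valueAt D q₂) hpos₁ hpos₂ hπ1 hπ2 hπ
  simp only [smul_eq_mul, mem_ofPred_eq] at hconv hmem
  have hlog := Real.convexOn_mul_log.2 (x := q₁) (y := q₂) h₁.1.le h₂.1.le ha hb hab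
  simp only [smul_eq_mul] at hlog
  rw [← hq] at hlog
  have hl₁ : a * q₁ / q * -Real.log (quantileOf D (valueAt D q₁)) ≤
      a * q₁ / q * -Real.log q₁ :=
    mul_le_mul_of_nonneg_left (neg_le_neg (Real.log_le_log h₁.1 hv₁)) hπ1
  have hl₂ : b * q₂ / q * -Real.log (quantileOf D (valueAt D q₂)) ≤
      b * q₂ / q * -Real.log q₂ :=
    mul_le_mul_of_nonneg_left (neg_le_neg (Real.log_le_log h₂.1 hv₂)) hπ2
  have hl₃ : Real.log q ≤ a * q₁ / q * Real.log q₁ + b * q₂ / q * Real.log q₂ := by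
    have : a * q₁ / q * Real.log q₁ + b * q₂ / q * Real.log q₂ =
        (a * (q₁ * Real.log q₁) + b * (q₂ * Real.log q₂)) / q := by ring
    rw [this, le_div_iff₀ hqI.1]
    linarith
  have hle : q ≤ quantileOf D (a * q₁ / q * valueAt D q₁ + b * q₂ / q * valueAt D q₂) := by
    rw [← Real.log_le_log_iff hqI.1 hmem]
    linarith
  have := (hD.le_valueAt_iff hqI.1 hqI.2 (add_nonneg (mul_nonneg hπ1 (valueAt_nonneg q₁))
    (mul_nonneg hπ2 (valueAt_nonneg q₂)))).2 hle
  calc a * (q₁ * valueAt D q₁) + b * (q₂ * valueAt D q₂)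
      = q * (a * q₁ / q * valueAt D q₁ + b * q₂ / q * valueAt D q₂) := by field_simp
    _ ≤ q * valueAt D q := mul_le_mul_of_nonneg_left this hqI.1.le

/-- For an MHR prior the quantile `exp (-1)` earns at least as much as any smaller one: the hazard
`Λ` is convex with `Λ 0 = 0`, so scaling a value `v` by `1 / Λ v` puts its hazard below `1`. -/
lemma IsMHRPrior.revenue_le_of_lt {D : Measure ℝ} (hD : IsPrior D) (h : IsMHRPrior D) {q : ℝ}
    (h0 : 0 < q) (h1 : q < Real.exp (-1)) :
    q * valueAt D q ≤ Real.exp (-1) * valueAt D (Real.exp (-1)) := by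
  have hexp1 : Real.exp (-1) ≤ 1 := by simp
  have hlog : Real.log q < -1 := (Real.log_lt_iff_lt_exp h0).2 h1
  set l := -Real.log q with hl
  have hl1 : 1 < l := by linarith
  have hl0 : 0 < l := by linarith
  have hv := hD.le_quantileOf_valueAt (q := q) (h1.le.trans hexp1)
  have hpos := h0.trans_le hv
  have hz : 0 < quantileOf D 0 := by rw [hD.quantileOf_zero]; exact one_pos
  have hl' : 0 ≤ 1 / l := by positivity
  have hw : 0 ≤ 1 - 1 / l := by
    rw [sub_nonneg, div_le_one hl0]
    exact hl1.le
  have hconv := h.2 (x := valueAt D q) (y := 0) hpos hz hl' hw (by ring)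
  have hmem := h.1 (x := valueAt D q) (y := 0) hpos hz hl' hw (by ring)
  simp only [smul_eq_mul, mem_ofPred_eq, mul_zero, add_zero, hD.quantileOf_zero, Real.log_one,
    neg_zero] at hconv hmem
  have h2 : 1 / l * -Real.log (quantileOf D (valueAt D q)) ≤ 1 / l * l :=
    mul_le_mul_of_nonneg_left (neg_le_neg (Real.log_le_log h0 hv)) (by positivity)
  rw [one_div_mul_cancel hl0.ne'] at h2
  have h3 : Real.exp (-1) ≤ quantileOf D (1 / l * valueAt D q) := by
    rw [← Real.le_log_iff_exp_le hmem]
    linarith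
  have h4 := (hD.le_valueAt_iff (Real.exp_pos _) hexp1
    (mul_nonneg (by positivity) (valueAt_nonneg q))).2 h3
  have h5 : q * l ≤ Real.exp (-1) := by
    have hq : q = Real.exp (-l) := by rw [hl, neg_neg, Real.exp_log h0]
    have : l ≤ Real.exp (l - 1) := by linarith [Real.add_one_le_exp (l - 1)]
    calc q * l ≤ q * Real.exp (l - 1) := by gcongr
      _ = Real.exp (-1) := by rw [hq, ← Real.exp_add]; ring_nf
  calc q * valueAt D q = q * l * (1 / l * valueAt D q) := by field_simp
    _ ≤ Real.exp (-1) * valueAt D (Real.exp (-1)) :=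
      mul_le_mul h5 h4 (mul_nonneg (by positivity) (valueAt_nonneg q)) (Real.exp_pos _).le

/-! ### Uniform deviation of the empirical distribution of uniform seeds -/

section Deviation

variable {ι : Type*} {N : ℕ}

/-- The number of seeds of the block `φ` that are at most `s`. -/
noncomputable def seedCount (φ : Fin N → ι) (u : ι → unitInterval) (s : ℝ) : ℕ :=
  (Finset.univ.filter fun j => (u (φ j) : ℝ) ≤ s).card

lemma seedCount_mono (φ : Fin N → ι) (u : ι → unitInterval) : Monotone (seedCount φ u) :=
  fun _ _ h => Finset.card_le_card (Finset.monotone_filter_right _ fun _ _ hj => le_trans hj h)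

lemma measurable_seedCount (φ : Fin N → ι) (s : ℝ) :
    Measurable fun u : ι → unitInterval => (seedCount φ u s : ℝ) := by
  have : (fun u : ι → unitInterval => (seedCount φ u s : ℝ)) =
      fun u => ∑ j, if (u (φ j) : ℝ) ≤ s then (1 : ℝ) else 0 := by
    ext u
    simp [seedCount]
  rw [this]
  exact Finset.measurable_sum _ fun j _ => Measurable.ite
    (measurableSet_le (measurable_subtype_coe.comp (measurable_pi_apply _)) measurable_const)
    measurable_const measurable_const

variable [Fintype ι]

lemma volume_real_seed_le (i : ι) {s : ℝ} (hs : s ∈ Icc (0 : ℝ) 1) :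
    (volume : Measure (ι → unitInterval)).real {u | (u i : ℝ) ≤ s} = s := by
  have h : {u : ι → unitInterval | (u i : ℝ) ≤ s} = Function.eval i ⁻¹' Iic ⟨s, hs⟩ := by
    ext u
    simp [← Subtype.coe_le_coe]
  rw [h, Measure.real, volume_pi,
    (measurePreserving_eval (fun _ : ι => (volume : Measure unitInterval)) i).measure_preimage
      measurableSet_Iic.nullMeasurableSet, unitInterval.volume_Iic, ENNReal.toReal_ofReal hs.1]

lemma mgf_seed_le (i : ι) {s : ℝ} (hs : s ∈ Icc (0 : ℝ) 1) (t : ℝ) :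
    ProbabilityTheory.mgf (fun u : ι → unitInterval => if (u i : ℝ) ≤ s then (1 : ℝ) else 0)
      volume t = 1 + s * (Real.exp t - 1) := by
  have hm : MeasurableSet {u : ι → unitInterval | (u i : ℝ) ≤ s} :=
    measurableSet_le (measurable_subtype_coe.comp (measurable_pi_apply i)) measurable_const
  have h : (fun u : ι → unitInterval => Real.exp (t * if (u i : ℝ) ≤ s then (1 : ℝ) else 0)) =
      fun u => 1 + {u : ι → unitInterval | (u i : ℝ) ≤ s}.indicator
        (fun _ => Real.exp t - 1) u := by
    ext u
    by_cases hu : (u i : ℝ) ≤ s <;> simp [indicator, hu]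
  rw [ProbabilityTheory.mgf, h, integral_add (integrable_const _)
    ((integrable_const _).indicator hm), integral_indicator_const _ hm, volume_real_seed_le i hs]
  simp

lemma mgf_seedCount_le {φ : Fin N → ι} (hφ : φ.Injective) {s t : ℝ} (hs : s ∈ Icc (0 : ℝ) 1)
    (ht : |t| ≤ 1) :
    ProbabilityTheory.mgf (fun u : ι → unitInterval => (seedCount φ u s : ℝ)) volume t ≤
      Real.exp (N * s * (t + t ^ 2)) := by
  let X : ι → (ι → unitInterval) → ℝ := fun i u => if (u i : ℝ) ≤ s then 1 else 0
  have hXm : ∀ i, Measurable (X i) := fun i => Measurable.ite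
    (measurableSet_le (measurable_subtype_coe.comp (measurable_pi_apply i)) measurable_const)
    measurable_const measurable_const
  have hind : ProbabilityTheory.iIndepFun X volume :=
    ProbabilityTheory.iIndepFun_pi (μ := fun _ : ι => (volume : Measure unitInterval))
      (X := fun _ x => if (x : ℝ) ≤ s then (1 : ℝ) else 0) fun i =>
        (Measurable.ite (measurableSet_le measurable_subtype_coe measurable_const)
          measurable_const measurable_const).aemeasurable
  have hsum : (fun u : ι → unitInterval => (seedCount φ u s : ℝ)) = ∑ j, X (φ j) := by
    ext u
    simp [seedCount, X, Finset.sum_apply]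
  have h1 : 1 + s * (Real.exp t - 1) ≤ Real.exp (s * (t + t ^ 2)) := by
    have := abs_le.1 (Real.abs_exp_sub_one_sub_id_le ht)
    have h2 := Real.add_one_le_exp (s * (t + t ^ 2))
    nlinarith [hs.1]
  have h0 : 0 ≤ 1 + s * (Real.exp t - 1) := by
    nlinarith [hs.1, hs.2, Real.exp_pos t]
  rw [hsum, (hind.precomp hφ).mgf_sum (fun j => hXm (φ j)) Finset.univ]
  simp_rw [X, mgf_seed_le _ hs]
  rw [Finset.prod_const, Finset.card_univ, Fintype.card_fin]
  calc _ ≤ Real.exp (s * (t + t ^ 2)) ^ N := pow_le_pow_left₀ h0 h1 N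
    _ = _ := by rw [← Real.exp_nat_mul]; ring_nf

lemma integrable_exp_mul_seedCount (φ : Fin N → ι) (s t : ℝ) :
    Integrable (fun u : ι → unitInterval => Real.exp (t * seedCount φ u s)) volume := by
  refine Integrable.of_bound
    (Real.measurable_exp.comp ((measurable_seedCount φ s).const_mul t)).aestronglyMeasurable
    (Real.exp (|t| * N)) (Filter.Eventually.of_forall fun u => ?_)
  rw [Real.norm_of_nonneg (Real.exp_pos _).le, Real.exp_le_exp]
  have h : (seedCount φ u s : ℝ) ≤ N := by
    exact_mod_cast (Finset.card_filter_le _ _).trans (by simp)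
  calc t * (seedCount φ u s : ℝ) ≤ |t| * seedCount φ u s := by gcongr; exact le_abs_self t
    _ ≤ |t| * N := by gcongr

/-- The multiplicative Chernoff bound for the number of seeds that are at most `s`. -/
lemma volume_real_seedCount_deviation_le {φ : Fin N → ι} (hφ : φ.Injective) {s σ τ : ℝ}
    (hs : s ∈ Icc (0 : ℝ) 1) (hσ : 0 < σ) (hsσ : s ≤ σ) (hτ : 0 ≤ τ) (hτ2 : τ ≤ 2 * σ) :
    (volume : Measure (ι → unitInterval)).real {u | N * τ ≤ |(seedCount φ u s : ℝ) - N * s|} ≤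
      2 * Real.exp (-(N * (τ ^ 2 / (4 * σ)))) := by
  -- the minimizer of `N * σ * t ^ 2 - t * (N * τ)`
  set t := τ / (2 * σ) with ht
  have ht0 : 0 ≤ t := by positivity
  have ht1 : t ≤ 1 := (div_le_one (by positivity)).2 hτ2
  have hexp : N * s * t ^ 2 - t * (N * τ) ≤ -(N * (τ ^ 2 / (4 * σ))) := by
    have h1 : N * s * t ^ 2 ≤ N * σ * t ^ 2 := by gcongr
    have h2 : N * σ * t ^ 2 - t * (N * τ) = -(N * (τ ^ 2 / (4 * σ))) := by
      rw [ht]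
      field_simp
      ring
    linarith
  have hup := ProbabilityTheory.measure_ge_le_exp_mul_mgf (N * s + N * τ) ht0
    (integrable_exp_mul_seedCount φ s t)
  have hlo := ProbabilityTheory.measure_le_le_exp_mul_mgf (N * s - N * τ) (neg_nonpos.2 ht0)
    (integrable_exp_mul_seedCount φ s (-t))
  have hup' : (volume : Measure (ι → unitInterval)).real
      {u | N * s + N * τ ≤ (seedCount φ u s : ℝ)} ≤ Real.exp (-(N * (τ ^ 2 / (4 * σ)))) := by
    refine hup.trans ((mul_le_mul_of_nonneg_left (mgf_seedCount_le hφ hs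
      (abs_le.2 ⟨by linarith, ht1⟩)) (Real.exp_pos _).le).trans ?_)
    rw [← Real.exp_add, Real.exp_le_exp]
    linarith
  have hlo' : (volume : Measure (ι → unitInterval)).real
      {u | (seedCount φ u s : ℝ) ≤ N * s - N * τ} ≤ Real.exp (-(N * (τ ^ 2 / (4 * σ)))) := by
    refine hlo.trans ((mul_le_mul_of_nonneg_left (mgf_seedCount_le hφ hs
      (abs_le.2 ⟨by linarith, by linarith⟩)) (Real.exp_pos _).le).trans ?_)
    rw [← Real.exp_add, Real.exp_le_exp]
    linarith
  have hsub : {u : ι → unitInterval | N * τ ≤ |(seedCount φ u s : ℝ) - N * s|} ⊆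
      {u | N * s + N * τ ≤ (seedCount φ u s : ℝ)} ∪
        {u | (seedCount φ u s : ℝ) ≤ N * s - N * τ} := by
    intro u hu
    rcases le_abs.1 (mem_ofPred_eq ▸ hu) with h | h
    · left
      simp only [mem_ofPred_eq]
      linarith
    · right
      simp only [mem_ofPred_eq]
      linarith
  calc _ ≤ _ := measureReal_mono hsub
    _ ≤ _ := measureReal_union_le _ _
    _ ≤ _ := by linarith

/-- The seeds of a block are positive and their empirical distribution function deviates from the
uniform one by at most `α * max s σ` at `s`. Positivity keeps the sampled quantiles away from `0`,
where `valueAt` is `0` as the supremum of an unbounded set. -/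
def BlockGood (φ : Fin N → ι) (α σ : ℝ) (u : ι → unitInterval) : Prop :=
  (∀ j, 0 < (u (φ j) : ℝ)) ∧
    ∀ s ∈ Icc (0 : ℝ) 1, |(seedCount φ u s : ℝ) - N * s| ≤ N * (α * max s σ)

/-- Monotonicity extends the Chernoff bound from a grid of mesh `α * σ / 3` to all `s`. -/
lemma volume_real_not_blockGood_le {φ : Fin N → ι} (hφ : φ.Injective) {α σ : ℝ}
    (hα : 0 < α) (hα1 : α ≤ 1) (hσ : 0 < σ) (hσ1 : σ ≤ 1) :
    (volume : Measure (ι → unitInterval)).real {u | ¬ BlockGood φ α σ u} ≤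
      12 / (α * σ) * Real.exp (-(N * (α ^ 2 * σ / 16))) := by
  obtain ⟨M, hM⟩ : ∃ M : ℕ, M = ⌈3 / (α * σ)⌉₊ := ⟨_, rfl⟩
  have hασ : α * σ ≤ 1 := mul_le_one₀ hα1 hσ.le hσ1
  have hασ0 : 0 < α * σ := mul_pos hα hσ
  have hM3 : 3 / (α * σ) ≤ M := hM ▸ Nat.le_ceil _
  have hM0 : (0 : ℝ) < M := lt_of_lt_of_le (by positivity) hM3
  have hM1 : 1 / (M : ℝ) ≤ α * σ / 3 := by
    rw [div_le_iff₀ hM0]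
    rw [div_le_iff₀ hασ0] at hM3
    linarith
  have hMle : (M : ℝ) + 1 ≤ 5 / (α * σ) := by
    have h1 : (M : ℝ) < 3 / (α * σ) + 1 := hM ▸ Nat.ceil_lt_add_one (by positivity)
    have h2 : 1 ≤ 1 / (α * σ) := (one_le_div hασ0).2 hασ
    have h3 : 5 / (α * σ) = 3 / (α * σ) + 2 * (1 / (α * σ)) := by ring
    linarith
  let B : ℕ → Set (ι → unitInterval) := fun g =>
    {u | N * (α / 2 * max ((g : ℝ) / M) σ) ≤ |(seedCount φ u ((g : ℝ) / M) : ℝ) - N * (g / M)|}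
  have hB : ∀ g ∈ Finset.range (M + 1), (volume : Measure (ι → unitInterval)).real (B g) ≤
      2 * Real.exp (-(N * (α ^ 2 * σ / 16))) := by
    intro g hg
    have hgM : (g : ℝ) ≤ M := by exact_mod_cast Nat.lt_succ_iff.1 (Finset.mem_range.1 hg)
    have hmax : 0 < max ((g : ℝ) / M) σ := lt_max_of_lt_right hσ
    refine (volume_real_seedCount_deviation_le hφ ⟨by positivity, (div_le_one hM0).2 hgM⟩
      hmax (le_max_left _ _) (by positivity) (by nlinarith)).trans ?_
    have : α ^ 2 * σ / 16 ≤ (α / 2 * max ((g : ℝ) / M) σ) ^ 2 / (4 * max ((g : ℝ) / M) σ) := by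
      rw [le_div_iff₀ (by positivity)]
      nlinarith [mul_nonneg (sq_nonneg α) (mul_nonneg hmax.le
        (sub_nonneg.2 (le_max_right ((g : ℝ) / M) σ)))]
    gcongr
  let Z : ι → Set (ι → unitInterval) := fun i => {u | (u i : ℝ) ≤ 0}
  have hZ : ∀ i, (volume : Measure (ι → unitInterval)).real (Z i) = 0 := fun i =>
    volume_real_seed_le i ⟨le_rfl, zero_le_one⟩
  have hsub : {u | ¬ BlockGood φ α σ u} ⊆ (⋃ i ∈ Finset.univ, Z i) ∪
      ⋃ g ∈ Finset.range (M + 1), B g := by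
    intro u hu
    by_contra hcon
    simp only [mem_union, mem_iUnion, not_or, not_exists, Finset.mem_range, Z, B, mem_ofPred_eq,
      not_le, Finset.mem_univ, forall_true_left] at hcon
    refine hu ⟨fun j => hcon.1 (φ j), fun s hs => ?_⟩
    obtain ⟨g, hg⟩ : ∃ g : ℕ, g = ⌊s * M⌋₊ := ⟨_, rfl⟩
    have hsM : 0 ≤ s * M := mul_nonneg hs.1 hM0.le
    have hgs : (g : ℝ) / M ≤ s := by
      rw [div_le_iff₀ hM0, hg]
      exact Nat.floor_le hsM
    have hsg : s ≤ (g : ℝ) / M + 1 / M := by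
      rw [← add_div, le_div_iff₀ hM0, hg]
      exact (Nat.lt_floor_add_one _).le
    have hgM : (g : ℝ) ≤ M := by
      rw [div_le_iff₀ hM0] at hgs
      nlinarith [hs.2]
    have hgM' : g ≤ M := by exact_mod_cast hgM
    have hmax : max ((g : ℝ) / M) σ ≤ max s σ := max_le_max_right _ hgs
    have hσm : σ ≤ max s σ := le_max_right _ _
    have hN : (0 : ℝ) ≤ N := Nat.cast_nonneg N
    have hlow := abs_lt.1 (hcon.2 g (by omega))
    have hmono : (seedCount φ u ((g : ℝ) / M) : ℝ) ≤ seedCount φ u s := by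
      exact_mod_cast seedCount_mono φ u hgs
    rw [abs_le]
    constructor
    · have h1 : N * (α / 2 * max ((g : ℝ) / M) σ) ≤ N * (α / 2 * max s σ) := by gcongr
      have h2 : N * s ≤ N * (g / M + α * max s σ / 3) := by
        gcongr
        nlinarith
      nlinarith [mul_nonneg hN (mul_nonneg hα.le (hσ.le.trans hσm))]
    · rcases hgM'.eq_or_lt with rfl | hlt
      · -- at the right end of the grid `s = 1`
        have hs1 : s = 1 := le_antisymm hs.2 (by rwa [div_self hM0.ne'] at hgs)
        rw [div_self hM0.ne', ← hs1] at hlow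
        have : N * (α / 2 * max s σ) ≤ N * (α * max s σ) := by
          gcongr
          linarith
        linarith
      · have hupp := abs_lt.1 (hcon.2 (g + 1) (by omega))
        have hsg' : s ≤ ((g + 1 : ℕ) : ℝ) / M := by
          push_cast
          rwa [add_div]
        have hmono' : (seedCount φ u s : ℝ) ≤ seedCount φ u (((g + 1 : ℕ) : ℝ) / M) := by
          exact_mod_cast seedCount_mono φ u hsg'
        have hgg : ((g + 1 : ℕ) : ℝ) / M ≤ s + α * σ / 3 := by
          push_cast
          rw [add_div]
          linarith
        have hmax' : max (((g + 1 : ℕ) : ℝ) / M) σ ≤ 4 / 3 * max s σ := by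
          refine max_le ?_ (by linarith)
          have : α * σ ≤ σ := by nlinarith
          linarith [le_max_left s σ]
        have h1 : N * (α / 2 * max (((g + 1 : ℕ) : ℝ) / M) σ) ≤
            N * (α / 2 * (4 / 3 * max s σ)) := by gcongr
        have h2 : N * (((g + 1 : ℕ) : ℝ) / M) ≤ N * (s + α * max s σ / 3) := by
          gcongr
          nlinarith
        linarith
  calc _ ≤ (volume : Measure (ι → unitInterval)).real (⋃ i ∈ Finset.univ, Z i) +
        (volume : Measure (ι → unitInterval)).real (⋃ g ∈ Finset.range (M + 1), B g) :=
        (measureReal_mono hsub).trans (measureReal_union_le _ _)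
    _ ≤ ∑ i, (volume : Measure (ι → unitInterval)).real (Z i) +
        ∑ g ∈ Finset.range (M + 1), (volume : Measure (ι → unitInterval)).real (B g) :=
        add_le_add (measureReal_biUnion_finset_le _ _) (measureReal_biUnion_finset_le _ _)
    _ ≤ 0 + ((M + 1 : ℕ) : ℝ) * (2 * Real.exp (-(N * (α ^ 2 * σ / 16)))) := by
        refine add_le_add (by simp [hZ]) ((Finset.sum_le_sum hB).trans ?_)
        simp
    _ ≤ 12 / (α * σ) * Real.exp (-(N * (α ^ 2 * σ / 16))) := by
        have hE := Real.exp_pos (-(N * (α ^ 2 * σ / 16)))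
        have : 2 * ((M : ℝ) + 1) ≤ 12 / (α * σ) := by
          have : 12 / (α * σ) = 2 * (5 / (α * σ)) + 2 / (α * σ) := by ring
          have : 0 ≤ 2 / (α * σ) := by positivity
          linarith
        push_cast
        nlinarith

/-- If every block is large enough then all of them are good with probability `1 - δ`: `X j` bounds
the inverse of the squared precision, and `n` the number of blocks. -/
lemma volume_real_exists_not_blockGood_le {J : Type*} [Fintype J] {N : J → ℕ}
    {φ : (j : J) → Fin (N j) → ι} (hφ : ∀ j, (φ j).Injective) {α σ X : J → ℝ} {n δ : ℝ}
    (hα : ∀ j, 0 < α j) (hα1 : ∀ j, α j ≤ 1) (hσ : ∀ j, 0 < σ j) (hσ1 : ∀ j, σ j ≤ 1)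
    (hX : ∀ j, 1 ≤ X j * (α j ^ 2 * σ j)) (hδ : 0 < δ) (hn : 0 < n) (hJ : Fintype.card J ≤ n)
    (hN : ∀ j, 16 * X j * Real.log (12 * n * X j / δ) ≤ N j) :
    (volume : Measure (ι → unitInterval)).real {u | ∃ j, ¬ BlockGood (φ j) (α j) (σ j) u} ≤ δ := by
  have hone : ∀ j, (volume : Measure (ι → unitInterval)).real
      {u | ¬ BlockGood (φ j) (α j) (σ j) u} ≤ δ / n := by
    intro j
    have hp : 0 < α j ^ 2 * σ j := mul_pos (pow_pos (hα j) 2) (hσ j)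
    have hXp : 0 < X j := by
      by_contra! h
      nlinarith [hX j]
    have hασ : 0 < α j * σ j := mul_pos (hα j) (hσ j)
    refine (volume_real_not_blockGood_le (hφ j) (hα j) (hα1 j) (hσ j) (hσ1 j)).trans ?_
    have h1 : 12 / (α j * σ j) ≤ 12 * X j := by
      rw [div_le_iff₀ hασ]
      have : α j ^ 2 * σ j ≤ α j * σ j := by nlinarith [hα j, hα1 j]
      nlinarith [hX j, mul_le_mul_of_nonneg_left this hXp.le]
    have h2 : Real.log (12 * n * X j / δ) ≤ N j * (α j ^ 2 * σ j / 16) := by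
      rcases le_total (Real.log (12 * n * X j / δ)) 0 with h | h
      · exact h.trans (by positivity)
      · have h3 := mul_le_mul_of_nonneg_right (hN j) (by positivity : 0 ≤ α j ^ 2 * σ j / 16)
        have h4 := mul_le_mul_of_nonneg_right (hX j) h
        nlinarith
    have h3 : Real.exp (-(N j * (α j ^ 2 * σ j / 16))) ≤ δ / (12 * n * X j) := by
      rw [← inv_div (12 * n * X j) δ, ← Real.exp_log (by positivity : 0 < 12 * n * X j / δ),
        ← Real.exp_neg, Real.exp_le_exp]
      linarith
    calc _ ≤ 12 * X j * (δ / (12 * n * X j)) := by gcongr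
      _ = δ / n := by field_simp
  have hset : {u | ∃ j, ¬ BlockGood (φ j) (α j) (σ j) u} =
      ⋃ j ∈ Finset.univ, {u | ¬ BlockGood (φ j) (α j) (σ j) u} := by
    ext u
    simp
  rw [hset]
  calc _ ≤ _ := measureReal_biUnion_finset_le _ _
    _ ≤ ∑ _j : J, δ / n := Finset.sum_le_sum fun j _ => hone j
    _ = Fintype.card J * (δ / n) := by simp
    _ ≤ n * (δ / n) := by gcongr
    _ = δ := by field_simp

end Deviation

/-! ### Algorithms that sample in rounds -/

/-- A family is learnable if some algorithm succeeds outside an event of probability `δ`. -/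
lemma Learnable.of_bad {family : Set (Measure ℝ)} {target : Measure ℝ → ℝ} {Δ δ : ℝ} {m : ℕ}
    (A : TargetedAlgorithm Δ m) (Bad : Set (Fin m → unitInterval))
    (hBad : (volume : Measure (Fin m → unitInterval)).real Bad ≤ δ)
    (h : ∀ D ∈ family, ∀ u, u ∉ Bad → target D ≤ (A.output (A.answers D u)).revenue D) :
    Learnable family target Δ δ m := by
  refine ⟨A, fun D hD => ?_⟩
  have hsub : (univ : Set (Fin m → unitInterval)) ⊆
      {u | target D ≤ (A.output (A.answers D u)).revenue D} ∪ Bad := by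
    intro u _
    by_cases hu : u ∈ Bad
    · exact Or.inr hu
    · exact Or.inl (h D hD u hu)
  have h1 := (measureReal_mono (μ := volume) hsub).trans (measureReal_union_le _ _)
  rw [probReal_univ] at h1
  rw [TargetedAlgorithm.successProb]
  linarith

/-- The state of an algorithm that works in rounds of `B` samples after `k` rounds, if its answers
are `a 0, a 1, …`. -/
def roundState {S : Type*} {B : ℕ} (s₀ : S) (upd : S → (Fin B → ℝ) → S) (a : ℕ → ℝ) : ℕ → S
  | 0 => s₀
  | k + 1 => upd (roundState s₀ upd a k) fun j => a (k * B + j)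

lemma roundState_congr {S : Type*} {B : ℕ} {s₀ : S} {upd : S → (Fin B → ℝ) → S} {a b : ℕ → ℝ}
    {k : ℕ} (h : ∀ i < k * B, a i = b i) : roundState s₀ upd a k = roundState s₀ upd b k := by
  induction k with
  | zero => rfl
  | succ k ih =>
    have hk : (k + 1) * B = k * B + B := by ring
    rw [roundState, roundState, ih fun i hi => h i (by omega)]
    congr 1
    ext j
    exact h _ (by omega)

/-- A finite list of answers, continued by zeros. -/
def zeroExtend {n : ℕ} (h : Fin n → ℝ) (i : ℕ) : ℝ := if hi : i < n then h ⟨i, hi⟩ else 0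

lemma measurable_zeroExtend {n : ℕ} (i : ℕ) : Measurable fun h : Fin n → ℝ => zeroExtend h i := by
  by_cases hi : i < n
  · simpa [zeroExtend, hi] using measurable_pi_apply _
  · simp [zeroExtend, hi]

lemma measurable_roundState {S : Type*} [MeasurableSpace S] {B n : ℕ} {s₀ : S}
    {upd : S → (Fin B → ℝ) → S} (hupd : Measurable fun z : S × (Fin B → ℝ) => upd z.1 z.2)
    (k : ℕ) : Measurable fun h : Fin n → ℝ => roundState s₀ upd (zeroExtend h) k := by
  induction k with
  | zero => exact measurable_const
  | succ k ih =>
    exact hupd.comp (ih.prodMk (measurable_pi_lambda _ fun j => measurable_zeroExtend _))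

/-- Sampling in `K` rounds of `B` samples: the windows `[win s j, win s j + w]` of a round depend
on the state `s` before it, and the answers of a round update the state. -/
lemma exists_roundAlgorithm {S : Type*} [MeasurableSpace S] {Δ w : ℝ} (K B : ℕ) (hΔ : Δ ≤ w)
    (s₀ : S) (win : S → Fin B → ℝ) (upd : S → (Fin B → ℝ) → S) (price : S → ℝ)
    (hwin0 : ∀ s j, 0 ≤ win s j) (hwin1 : ∀ s j, win s j + w ≤ 1)
    (hwin : ∀ j, Measurable fun s => win s j)
    (hupd : Measurable fun z : S × (Fin B → ℝ) => upd z.1 z.2) (hprice : Measurable price) :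
    ∃ A : TargetedAlgorithm Δ (K * B), ∀ D u, ∃ st : ℕ → S, st 0 = s₀ ∧
      (∀ k : Fin K, st (k + 1) = upd (st k) fun j =>
        valueAt D (win (st k) j + (u (finProdFinEquiv (k, j)) : ℝ) * w)) ∧
      A.output (A.answers D u) = postedPrice (price (st K)) := by
  have hB : ∀ i : Fin (K * B), 0 < B := fun i => Nat.pos_of_ne_zero fun h => by
    have := i.isLt
    simp [h] at this
  let a : (i : Fin (K * B)) → (Fin i → ℝ) → ℝ := fun i h =>
    win (roundState s₀ upd (zeroExtend h) (i / B)) ⟨i % B, Nat.mod_lt _ (hB i)⟩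
  have ha : ∀ i, Measurable (a i) := fun i => (hwin _).comp (measurable_roundState hupd _)
  have hm := measurable_postedPrice
    (hprice.comp (measurable_roundState (n := K * B) (s₀ := s₀) hupd K))
  refine ⟨⟨a, fun i h => a i h + w, fun i h => hwin0 _ _, fun i h => hwin1 _ _,
    fun i h => by linarith, fun h => postedPrice (price (roundState s₀ upd (zeroExtend h) K)),
    ha, fun i => (ha i).add_const w, hm.1, hm.2⟩, fun D u => ?_⟩
  set A : TargetedAlgorithm Δ (K * B) := ⟨a, fun i h => a i h + w, fun i h => hwin0 _ _,
    fun i h => hwin1 _ _, fun i h => by linarith,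
    fun h => postedPrice (price (roundState s₀ upd (zeroExtend h) K)),
    ha, fun i => (ha i).add_const w, hm.1, hm.2⟩ with hA
  refine ⟨roundState s₀ upd (zeroExtend (A.answers D u)), rfl, fun k => ?_, rfl⟩
  rw [roundState]
  congr 1
  ext j
  have hval : (finProdFinEquiv (k, j)).val = j + B * k := by simp [finProdFinEquiv]
  have hidx : (k : ℕ) * B + j = finProdFinEquiv (k, j) := by rw [hval]; ring
  have hdiv : (finProdFinEquiv (k, j)).val / B = k := by
    rw [hval, Nat.add_mul_div_left _ _ j.pos, Nat.div_eq_of_lt j.isLt, zero_add]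
  have hmod : (finProdFinEquiv (k, j)).val % B = j := by
    rw [hval, Nat.add_mul_mod_self_left, Nat.mod_eq_of_lt j.isLt]
  have hz : zeroExtend (A.answers D u) (k * B + j) = A.answers D u (finProdFinEquiv (k, j)) := by
    rw [hidx, zeroExtend, dif_pos (finProdFinEquiv (k, j)).isLt]
  rw [hz, TargetedAlgorithm.answers, targetedSample]
  have hst : A.lo (finProdFinEquiv (k, j)) (fun i => A.answers D u
      ⟨i, i.isLt.trans (finProdFinEquiv (k, j)).isLt⟩) =
      win (roundState s₀ upd (zeroExtend (A.answers D u)) k) j := by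
    change win _ _ = _
    have hj : (⟨(finProdFinEquiv (k, j)).val % B,
        Nat.mod_lt _ (hB (finProdFinEquiv (k, j)))⟩ : Fin B) = j := Fin.ext hmod
    rw [hj, hdiv]
    congr 1
    refine roundState_congr fun i hi => ?_
    have h1 : i < (finProdFinEquiv (k, j)).val := by rw [← hidx]; omega
    have h2 : i < K * B := h1.trans (finProdFinEquiv (k, j)).isLt
    rw [zeroExtend, zeroExtend, dif_pos h1, dif_pos h2]
  have hhi : ∀ i h, A.hi i h = A.lo i h + w := fun _ _ => rfl
  rw [hhi, hst, add_sub_cancel_left]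

/-! ### Stratified sampling -/

section Stratified

variable {I : Type*} [Fintype I]

/-- The quantile of the price `p` as estimated from answers `z i` with weights `wt i`. -/
noncomputable def estQuantile (wt z : I → ℝ) (p : ℝ) : ℝ := ∑ i, if p ≤ z i then wt i else 0

/-- An answer of largest estimated revenue (see `exists_bestPrice_eq`), written as a maximum so
that it depends measurably on the answers. -/
noncomputable def bestPrice [Nonempty I] (wt z : I → ℝ) : ℝ :=
  Finset.univ.sup' Finset.univ_nonempty fun i =>
    if ∀ k, z k * estQuantile wt z (z k) ≤ z i * estQuantile wt z (z i) then z i else 0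

lemma exists_bestPrice_eq [Nonempty I] (wt : I → ℝ) {z : I → ℝ} (hz : ∀ i, 0 ≤ z i) :
    ∃ i, bestPrice wt z = z i ∧
      ∀ k, z k * estQuantile wt z (z k) ≤ z i * estQuantile wt z (z i) := by
  obtain ⟨m, hm⟩ := Finite.exists_max fun i => z i * estQuantile wt z (z i)
  obtain ⟨i, -, hi⟩ := Finset.exists_mem_eq_sup' (s := Finset.univ) Finset.univ_nonempty fun i =>
    if ∀ k, z k * estQuantile wt z (z k) ≤ z i * estQuantile wt z (z i) then z i else 0
  by_cases h : ∀ k, z k * estQuantile wt z (z k) ≤ z i * estQuantile wt z (z i)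
  · exact ⟨i, by rw [bestPrice, hi, if_pos h], h⟩
  · refine ⟨m, ?_, hm⟩
    rw [if_neg h] at hi
    have := Finset.le_sup' (f := fun i => if ∀ k, z k * estQuantile wt z (z k) ≤
      z i * estQuantile wt z (z i) then z i else 0) (Finset.mem_univ m)
    rw [hi] at this
    simp only [if_pos hm] at this
    rw [bestPrice, hi]
    exact le_antisymm (hz m) this

lemma measurable_bestPrice [Nonempty I] (wt : I → ℝ) : Measurable (bestPrice wt) := by
  have hq : ∀ i, Measurable fun z : I → ℝ => z i * estQuantile wt z (z i) := fun i =>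
    (measurable_pi_apply i).mul (Finset.measurable_sum _ fun k _ => Measurable.ite
      (measurableSet_le (measurable_pi_apply i) (measurable_pi_apply k)) measurable_const
      measurable_const)
  have : bestPrice wt = Finset.univ.sup' Finset.univ_nonempty fun (i : I) (z : I → ℝ) =>
      if ∀ k, z k * estQuantile wt z (z k) ≤ z i * estQuantile wt z (z i) then z i else 0 := by
    ext z
    simp [bestPrice, Finset.sup'_apply]
  rw [this]
  refine Finset.measurable_sup' _ fun i _ => Measurable.ite ?_ (measurable_pi_apply i)
    measurable_const
  have : {z : I → ℝ | ∀ k, z k * estQuantile wt z (z k) ≤ z i * estQuantile wt z (z i)} =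
      ⋂ k, {z | z k * estQuantile wt z (z k) ≤ z i * estQuantile wt z (z i)} := by
    ext z
    simp
  rw [this]
  exact MeasurableSet.iInter fun k => measurableSet_le (hq k) (hq i)

/-- The answers `z i = valueAt D (y i)` have the quantiles `y i` of bounded discrepancy `e`. Then
the estimated quantile of a price is the empirical distribution of the `y i` at its true quantile,
so the best price competes with every quantile `q` that exceeds the discrepancy. -/
lemma bestPrice_revenue [Nonempty I] {D : Measure ℝ} (hD : IsPrior D) {wt y : I → ℝ}
    (hy : ∀ i, y i ∈ Ioc (0 : ℝ) 1) {e : ℝ → ℝ} (he : Monotone e) (hepos : ∀ q, 0 < e q)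
    (hwt : ∀ i, 0 ≤ wt i)
    (hF : ∀ q ∈ Ioc (0 : ℝ) 1, |(∑ i, if y i ≤ q then wt i else 0) - q| ≤ e q) :
    (∃ q ∈ Ioc (0 : ℝ) 1, bestPrice wt (fun i => valueAt D (y i)) = valueAt D q) ∧
    ∀ q ∈ Ioc (0 : ℝ) 1, 3 * e q < q → (q - 4 * e q) * valueAt D q ≤
      bestPrice wt (fun i => valueAt D (y i)) *
        (quantileOf D (bestPrice wt fun i => valueAt D (y i)) +
          e (quantileOf D (bestPrice wt fun i => valueAt D (y i)))) := by
  have := hD.prob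
  set z : I → ℝ := fun i => valueAt D (y i) with hz
  obtain ⟨m, hm, hmax⟩ := exists_bestPrice_eq wt (z := z) fun i => valueAt_nonneg _
  have hest : ∀ p, 0 ≤ p → estQuantile wt z p = ∑ i, if y i ≤ quantileOf D p then wt i else 0 := by
    intro p hp
    refine Finset.sum_congr rfl fun i _ => ?_
    simp only [hz, hD.le_valueAt_iff (hy i).1 (hy i).2 hp]
  have hQ : ∀ i, quantileOf D (z i) ∈ Ioc (0 : ℝ) 1 := fun i =>
    ⟨(hy i).1.trans_le (hD.le_quantileOf_valueAt (hy i).2), quantileOf_le_one _⟩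
  refine ⟨⟨y m, hy m, hm⟩, fun q hq hqe => ?_⟩
  have hmono : ∀ {a b : ℝ}, a ≤ b → (∑ i, if y i ≤ a then wt i else 0) ≤
      ∑ i, if y i ≤ b then wt i else 0 := by
    intro a b hab
    refine Finset.sum_le_sum fun i _ => ?_
    split_ifs with h1 h2
    · exact le_rfl
    · exact absurd (h1.trans hab) h2
    · exact hwt i
    · exact le_rfl
  -- more mass is counted at `q` than at `q - 3 * e q`, so some sample lies between them
  have hq' : q - 3 * e q ∈ Ioc (0 : ℝ) 1 := ⟨by linarith, by linarith [hq.2, hepos q]⟩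
  have h1 := abs_le.1 (hF q hq)
  have h2 := abs_le.1 (hF _ hq')
  have h3 : e (q - 3 * e q) ≤ e q := he (by linarith [hepos q])
  obtain ⟨i, hi1, hi2⟩ : ∃ i, y i ≤ q ∧ ¬ y i ≤ q - 3 * e q := by
    by_contra! hcon
    have : (∑ i, if y i ≤ q then wt i else 0) ≤ ∑ i, if y i ≤ q - 3 * e q then wt i else 0 := by
      refine Finset.sum_le_sum fun i _ => ?_
      split_ifs with h1 h2
      · exact le_rfl
      · exact absurd (hcon i h1) h2
      · exact hwt i
      · exact le_rfl
    linarith [hepos q]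
  have hzi : valueAt D q ≤ z i := hD.valueAt_le_valueAt (hy i).1 hi1 hq.2
  have hqi : q - 4 * e q ≤ estQuantile wt z (z i) := by
    rw [hest _ (valueAt_nonneg _)]
    have := hmono ((not_le.1 hi2).le.trans (hD.le_quantileOf_valueAt (hy i).2))
    linarith
  have hnn : 0 ≤ estQuantile wt z (z i) := Finset.sum_nonneg fun k _ => by
    split_ifs
    exacts [hwt k, le_rfl]
  have h4 := abs_le.1 (hF _ (hQ m))
  rw [hm]
  calc (q - 4 * e q) * valueAt D q ≤ estQuantile wt z (z i) * z i := by
        rcases le_total (q - 4 * e q) 0 with h | h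
        · exact (mul_nonpos_of_nonpos_of_nonneg h (valueAt_nonneg q)).trans
            (mul_nonneg hnn (valueAt_nonneg _))
        · exact mul_le_mul hqi hzi (valueAt_nonneg q) hnn
    _ ≤ z m * estQuantile wt z (z m) := by rw [mul_comm]; exact hmax i
    _ ≤ z m * (quantileOf D (z m) + e (quantileOf D (z m))) := by
        refine mul_le_mul_of_nonneg_left ?_ (valueAt_nonneg _)
        rw [hest _ (valueAt_nonneg _)]
        linarith

/-- In a partition of `[0, 1]` into `K` windows with good blocks of samples, the weighted empirical
distribution has discrepancy `e`. -/
lemma stratified_discrepancy {ι : Type*} {K : ℕ} (hK : 0 < K) {N : Fin K → ℕ} (hN : ∀ j, 0 < N j)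
    {φ : (j : Fin K) → Fin (N j) → ι} {u : ι → unitInterval} {α σ : Fin K → ℝ} {e : ℝ → ℝ}
    (hgood : ∀ j, BlockGood (φ j) (α j) (σ j) u)
    (he : ∀ j : Fin K, ∀ s ∈ Icc (0 : ℝ) 1, α j * max s (σ j) ≤ K * e ((j + s) / K))
    {q : ℝ} (hq : q ∈ Ioc (0 : ℝ) 1) :
    |(∑ i : (j : Fin K) × Fin (N j), if (i.1 : ℝ) / K + (u (φ i.1 i.2) : ℝ) * (1 / K) ≤ q
      then 1 / ((K : ℝ) * N i.1) else 0) - q| ≤ e q := by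
  have hK0 : (0 : ℝ) < K := by exact_mod_cast hK
  obtain ⟨n, hn⟩ : ∃ n : ℕ, n = ⌈q * K⌉₊ := ⟨_, rfl⟩
  have hqK : 0 < q * K := mul_pos hq.1 hK0
  have hnpos : 0 < n := hn ▸ Nat.ceil_pos.2 hqK
  have hn1 : q * K ≤ n := hn ▸ Nat.le_ceil _
  have hn2 : (n : ℝ) < q * K + 1 := hn ▸ Nat.ceil_lt_add_one hqK.le
  have hnK : n ≤ K := by
    rw [hn, Nat.ceil_le]
    nlinarith [hq.2]
  obtain ⟨j, rfl⟩ : ∃ j, n = j + 1 := ⟨n - 1, by omega⟩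
  have hjK : j < K := by omega
  push_cast at hn1 hn2
  set s : ℝ := q * K - j with hs
  have hsI : s ∈ Icc (0 : ℝ) 1 := ⟨by linarith, by linarith⟩
  have hqs : q = (j + s) / K := by rw [hs]; field_simp; ring
  have hiff : ∀ (a t : ℝ), a / K + t * (1 / K) ≤ q ↔ a + t ≤ j + s := by
    intro a t
    rw [hqs, mul_one_div, ← add_div, div_le_div_iff_of_pos_right hK0]
  set x : ℝ := ((seedCount (φ ⟨j, hjK⟩) u s : ℕ) : ℝ) with hx
  let g : ℕ → ℝ := fun l => if l < j then 1 / (K : ℝ) else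
    if l = j then x / (K * N ⟨j, hjK⟩) else 0
  have hsum : (∑ i : (j : Fin K) × Fin (N j), if (i.1 : ℝ) / K + (u (φ i.1 i.2) : ℝ) * (1 / K) ≤ q
      then 1 / ((K : ℝ) * N i.1) else 0) = ∑ l : Fin K, g l := by
    rw [Fintype.sum_sigma]
    refine Finset.sum_congr rfl fun l _ => ?_
    have hNl : (0 : ℝ) < N l := by exact_mod_cast hN l
    simp only [g, hiff]
    split_ifs with h1 h2
    · have h1' : ((l : ℕ) : ℝ) + 1 ≤ j := by exact_mod_cast h1
      rw [Finset.sum_congr rfl fun i _ => if_pos (by linarith [(u (φ l i)).2.2, hsI.1])]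
      simp only [Finset.sum_const, Finset.card_univ, Fintype.card_fin, nsmul_eq_mul]
      field_simp
    · obtain rfl : l = ⟨j, hjK⟩ := Fin.ext h2
      simp only [add_le_add_iff_left]
      rw [← Finset.sum_filter, Finset.sum_const, nsmul_eq_mul, mul_one_div]
      rfl
    · have h1' : (j : ℝ) + 1 ≤ (l : ℕ) := by exact_mod_cast (by omega : j + 1 ≤ (l : ℕ))
      refine Finset.sum_eq_zero fun i _ => if_neg ?_
      have := (hgood l).1 i
      rw [not_le]
      linarith [hsI.2]
  have hg : ∑ l : Fin K, g l = j / K + x / (K * N ⟨j, hjK⟩) := by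
    rw [Fin.sum_univ_eq_sum_range g K, ← Finset.sum_subset (Finset.range_subset_range.2 hnK),
      Finset.sum_range_succ]
    · rw [Finset.sum_congr rfl fun l hl => if_pos (Finset.mem_range.1 hl)]
      simp [g, div_eq_mul_inv]
    · intro l _ hl
      have : j + 1 ≤ l := by simpa using hl
      simp only [g]
      rw [if_neg (by omega), if_neg (by omega)]
  have hNj : (0 : ℝ) < N ⟨j, hjK⟩ := by exact_mod_cast hN _
  have hdev := (hgood ⟨j, hjK⟩).2 s hsI
  have hα := he ⟨j, hjK⟩ s hsI
  rw [hsum, hg]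
  have : (j : ℝ) / K + x / (K * N ⟨j, hjK⟩) - q = (x - N ⟨j, hjK⟩ * s) / (K * N ⟨j, hjK⟩) := by
    rw [hqs]
    field_simp
    ring
  rw [this, abs_div, abs_of_pos (mul_pos hK0 hNj), div_le_iff₀ (mul_pos hK0 hNj)]
  refine hdev.trans ?_
  rw [hqs]
  have := mul_le_mul_of_nonneg_left hα hNj.le
  simp only at this
  linarith

/-- Stratified sampling learns whenever a best price, in the sense of `bestPrice_revenue`, meets
the target. -/
lemma learnable_of_stratified {family : Set (Measure ℝ)} {target : Measure ℝ → ℝ} {Δ δ n : ℝ}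
    {K : ℕ} (hK : 0 < K) (hΔ : Δ ≤ 1 / K) {N : Fin K → ℕ} {α σ X : Fin K → ℝ} {e : ℝ → ℝ}
    (hα : ∀ j, 0 < α j) (hα1 : ∀ j, α j ≤ 1) (hσ : ∀ j, 0 < σ j) (hσ1 : ∀ j, σ j ≤ 1)
    (hX : ∀ j, 1 ≤ X j * (α j ^ 2 * σ j)) (hδ : 0 < δ) (hn : K ≤ n)
    (hNpos : ∀ j, 0 < N j) (hN : ∀ j, 16 * X j * Real.log (12 * n * X j / δ) ≤ N j)
    (he : ∀ j : Fin K, ∀ s ∈ Icc (0 : ℝ) 1, α j * max s (σ j) ≤ K * e ((j + s) / K))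
    (hemono : Monotone e) (hepos : ∀ q, 0 < e q)
    (hprior : ∀ D ∈ family, IsPrior D)
    (htarget : ∀ D ∈ family, ∀ p, (∃ q ∈ Ioc (0 : ℝ) 1, p = valueAt D q) →
      (∀ q ∈ Ioc (0 : ℝ) 1, 3 * e q < q → (q - 4 * e q) * valueAt D q ≤
        p * (quantileOf D p + e (quantileOf D p))) → target D ≤ p * quantileOf D p) :
    Learnable family target Δ δ (∑ j, N j) := by
  have hK0 : (0 : ℝ) < K := by exact_mod_cast hK
  have : Nonempty ((j : Fin K) × Fin (N j)) := ⟨⟨⟨0, hK⟩, ⟨0, hNpos _⟩⟩⟩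
  let E : (j : Fin K) × Fin (N j) ≃ Fin (∑ j, N j) := finSigmaFinEquiv
  let wt : (j : Fin K) × Fin (N j) → ℝ := fun i => 1 / ((K : ℝ) * N i.1)
  obtain ⟨A, hA⟩ := exists_roundAlgorithm (S := Fin (∑ j, N j) → ℝ) (Δ := Δ) (w := 1 / K) 1
    (∑ j, N j) hΔ 0 (fun _ i => ((E.symm i).1 : ℝ) / K) (fun _ a => a)
    (fun a => bestPrice wt fun i => a (E i)) (fun _ _ => by positivity)
    (fun _ i => by
      rw [← add_div, div_le_one hK0]
      exact_mod_cast (E.symm i).1.isLt)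
    (fun _ => measurable_const) measurable_snd
    ((measurable_bestPrice wt).comp (measurable_pi_lambda _ fun i => measurable_pi_apply _))
  let φ : (j : Fin K) → Fin (N j) → Fin (1 * ∑ j, N j) := fun j i => finProdFinEquiv (0, E ⟨j, i⟩)
  have hφ : ∀ j, (φ j).Injective := fun j a b hab => by
    have h1 := E.injective (Prod.mk.inj (finProdFinEquiv.injective hab)).2
    simpa using h1
  rw [← one_mul (∑ j, N j)]
  refine Learnable.of_bad A {u | ∃ j, ¬ BlockGood (φ j) (α j) (σ j) u}
    (volume_real_exists_not_blockGood_le hφ hα hα1 hσ hσ1 hX hδ (hK0.trans_le hn)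
      (by simpa using hn) hN) fun D hD u hu => ?_
  simp only [mem_ofPred_eq, not_exists, not_not] at hu
  obtain ⟨st, h0, h1, hout⟩ := hA D u
  let y : (j : Fin K) × Fin (N j) → ℝ := fun i => (i.1 : ℝ) / K + (u (φ i.1 i.2) : ℝ) * (1 / K)
  have hst : (fun i => st (1 : ℕ) (E i)) = fun i => valueAt D (y i) := by
    ext i
    have h2 := congrFun (h1 0) (E i)
    simp only [Equiv.symm_apply_apply] at h2
    exact h2
  have hy : ∀ i, y i ∈ Ioc (0 : ℝ) 1 := by
    intro i
    have hu0 := (hu i.1).1 i.2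
    have hu1 := (u (φ i.1 i.2)).2.2
    have hi : ((i.1 : ℕ) : ℝ) + 1 ≤ K := by exact_mod_cast i.1.isLt
    refine ⟨by positivity, ?_⟩
    simp only [y]
    rw [mul_one_div, ← add_div, div_le_one hK0]
    linarith
  obtain ⟨hq, hbest⟩ := bestPrice_revenue (hprior D hD) hy hemono hepos
    (fun i => by positivity : ∀ i, 0 ≤ wt i)
    (fun q hq => stratified_discrepancy hK hNpos hu he hq)
  rw [hout, hst, revenue_postedPrice (by obtain ⟨q, -, hq⟩ := hq; rw [hq]; exact valueAt_nonneg q)]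
  exact htarget D hD _ hq hbest

end Stratified

/-! ### Bounded priors -/

lemma valueAt_le_of_boundedPriors {D : Measure ℝ} {a b q : ℝ} (hD : D ∈ boundedPriors a b)
    (hq : q ∈ Ioc (0 : ℝ) 1) : valueAt D q ≤ b := by
  by_contra! h
  have hsub : Ici (valueAt D q) ⊆ (Icc a b)ᶜ := fun x hx hx' =>
    absurd ((mem_Icc.1 hx').2.trans_lt h) (not_lt.2 (mem_Ici.1 hx))
  have h0 : D (Ici (valueAt D q)) = 0 := measure_mono_null hsub hD.2
  have h1 : q ≤ 0 := by
    simpa [quantileOf, Measure.real, h0] using hD.1.le_quantileOf_valueAt hq.2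
  exact absurd hq.1 (not_lt.2 h1)

lemma le_valueAt_of_boundedPriors {D : Measure ℝ} {a b : ℝ} (hD : D ∈ boundedPriors a b)
    (ha : 0 ≤ a) : a ≤ valueAt D 1 := by
  have := hD.1.prob
  rw [hD.1.le_valueAt_iff one_pos le_rfl ha]
  have h : D (Ici a)ᶜ = 0 := measure_mono_null (compl_subset_compl.2 Icc_subset_Ici_self) hD.2
  have := (prob_compl_eq_zero_iff (μ := D) measurableSet_Ici).1 h
  simp [quantileOf, Measure.real, this]

lemma exists_window_count {d : ℝ} (hd : 0 < d) (hd1 : d < 1) :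
    ∃ K : ℕ, 0 < K ∧ d * K ≤ 1 ∧ 1 ≤ 2 * d * K := by
  have h1 : (1 : ℝ) ≤ 1 / d := (one_le_div hd).2 hd1.le
  have hK : 0 < ⌊1 / d⌋₊ := Nat.floor_pos.2 h1
  have hK1 : (1 : ℝ) ≤ ⌊1 / d⌋₊ := by exact_mod_cast hK
  refine ⟨⌊1 / d⌋₊, hK, ?_, ?_⟩
  · rw [mul_comm, ← le_div_iff₀ hd]
    exact Nat.floor_le (by positivity)
  · have := Nat.lt_floor_add_one (1 / d)
    rw [div_lt_iff₀ hd] at this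
    nlinarith

lemma one_le_log {x : ℝ} (hx : 3 ≤ x) : 1 ≤ Real.log x := by
  rw [Real.le_log_iff_exp_le (by linarith)]
  linarith [Real.exp_one_lt_three]

lemma ceil_le_of_one_le {X L : ℝ} (hX : 1 ≤ X) (hL : 1 ≤ L) :
    (⌈16 * X * L⌉₊ : ℝ) ≤ 17 * X * L := by
  have h1 : 1 ≤ X * L := one_le_mul_of_one_le_of_one_le hX hL
  have := Nat.ceil_lt_add_one (by positivity : 0 ≤ 16 * X * L)
  linarith

/-- For values in `[0, 1]` a discrepancy of `ε / 5` costs at most `ε`; windows of width about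
`Δ₁ = max Δ ε` with `(Δ₁ / ε) ^ 2` samples each achieve it. -/
lemma learnable_boundedPriors_zero_one {ε Δ δ : ℝ} (hε : 0 < ε) (hε1 : ε < 1)
    (hΔ1 : Δ < 1) (hδ : 0 < δ) (hδ1 : δ < 1) :
    ∃ m : ℕ, (m : ℝ) ≤ 510000 * (1 + Real.log (1 / ε) + Real.log (1 / δ)) ^ 1 *
        max (1 / ε) (Δ / ε ^ 2) ∧
      Learnable (boundedPriors 0 1) (fun D => optRevenue D - ε) Δ δ m := by
  obtain ⟨K, hK, hK1, hK2⟩ := exists_window_count (d := max Δ ε) (lt_max_of_lt_right hε)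
    (max_lt hΔ1 hε1)
  have hK0 : (0 : ℝ) < K := by exact_mod_cast hK
  have hεK : ε * K ≤ 1 := le_trans (by gcongr; exact le_max_right _ _) hK1
  have hεK0 : 0 < ε * K := by positivity
  set X : ℝ := 25 / (ε * K) ^ 2 with hX
  have hX25 : 25 ≤ X := by
    rw [hX, le_div_iff₀ (by positivity)]
    nlinarith
  set L : ℝ := Real.log (12 * K * X / δ) with hL
  have harg : 3 ≤ 12 * K * X / δ := by
    rw [le_div_iff₀ hδ]
    have : (1 : ℝ) ≤ K := by exact_mod_cast hK
    nlinarith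
  have hL1 : 1 ≤ L := one_le_log harg
  set T : ℝ := 1 + Real.log (1 / ε) + Real.log (1 / δ) with hT
  have hlε : 0 ≤ Real.log (1 / ε) := Real.log_nonneg ((one_le_div hε).2 hε1.le)
  have hlδ : 0 ≤ Real.log (1 / δ) := Real.log_nonneg ((one_le_div hδ).2 hδ1.le)
  have hM : max Δ ε / ε ^ 2 = max (1 / ε) (Δ / ε ^ 2) := by
    have h1 : (1 : ℝ) / ε = ε / ε ^ 2 := by field_simp
    rw [h1, max_comm, max_div_div_right (by positivity)]
  have hKX : K * X ≤ 50 * (max Δ ε / ε ^ 2) := by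
    have : K * X = 25 / (ε ^ 2 * K) := by rw [hX]; field_simp
    rw [this, div_le_iff₀ (by positivity)]
    have : 50 * (max Δ ε / ε ^ 2) * (ε ^ 2 * K) = 25 * (2 * max Δ ε * K) := by
      field_simp
      ring
    linarith
  have hLT : L ≤ 600 * T := by
    have h1 : 12 * K * X / δ ≤ 600 * (1 / ε) * (1 / ε) * (1 / δ) := by
      have h2 : max Δ ε ≤ 1 := max_le hΔ1.le hε1.le
      have h3 : 12 * K * X ≤ 600 * (1 / ε ^ 2) := by
        have : max Δ ε / ε ^ 2 ≤ 1 / ε ^ 2 := by gcongr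
        linarith
      calc 12 * K * X / δ ≤ 600 * (1 / ε ^ 2) / δ := by gcongr
        _ = _ := by field_simp
    have h2 := Real.log_le_log (by linarith) h1
    rw [Real.log_mul (by positivity) (by positivity), Real.log_mul (by positivity) (by positivity),
      Real.log_mul (by positivity) (by positivity)] at h2
    have h3 := Real.log_le_sub_one_of_pos (by norm_num : (0 : ℝ) < 600)
    linarith
  refine ⟨∑ _j : Fin K, ⌈16 * X * L⌉₊, ?_, learnable_of_stratified hK (n := K)
    (α := fun _ => ε * K / 5) (σ := fun _ => 1) (X := fun _ => X) (e := fun _ => ε / 5)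
    ?_ (fun _ => by positivity) (fun _ => by linarith) (fun _ => one_pos) (fun _ => le_rfl)
    (fun _ => ?_) hδ le_rfl (fun _ => Nat.ceil_pos.2 (by positivity)) (fun _ => Nat.le_ceil _)
    (fun j s hs => ?_) monotone_const (fun _ => by positivity) (fun D hD => hD.1)
    fun D hD p hp hbest => ?_⟩
  · push_cast
    simp only [Finset.sum_const, Finset.card_univ, Fintype.card_fin, nsmul_eq_mul]
    calc (K : ℝ) * ⌈16 * X * L⌉₊ ≤ K * (17 * X * L) := by
          gcongr
          exact ceil_le_of_one_le (by linarith) hL1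
      _ = 17 * (K * X) * L := by ring
      _ ≤ 17 * (50 * (max Δ ε / ε ^ 2)) * (600 * T) := by gcongr
      _ = 510000 * T ^ 1 * max (1 / ε) (Δ / ε ^ 2) := by rw [← hM]; ring
  · rw [le_div_iff₀ hK0]
    exact le_trans (by gcongr; exact le_max_left _ _) hK1
  · rw [hX]
    refine le_of_eq ?_
    field_simp
    norm_num
  · rw [max_eq_right hs.2]
    linarith
  · obtain ⟨q₀, hq₀, rfl⟩ := hp
    have hp1 := valueAt_le_of_boundedPriors hD hq₀
    have hp0 := valueAt_nonneg (D := D) q₀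
    have hQ := quantileOf_nonneg (D := D) (valueAt D q₀)
    have : optRevenue D ≤ valueAt D q₀ * quantileOf D (valueAt D q₀) + ε := by
      refine optRevenue_le hD.1 fun q h0 h1 => ?_
      have hq1 := valueAt_le_of_boundedPriors hD ⟨h0, h1⟩
      have hq0 := valueAt_nonneg (D := D) q
      rcases lt_or_ge (3 * (ε / 5)) q with h | h
      · have := hbest q ⟨h0, h1⟩ h
        nlinarith
      · nlinarith [mul_nonneg hp0 hQ]
    linarith

/-- Competing with all quantiles `q ≥ 1 / H` up to the discrepancy `ε / 5 * max q (1 / H)` is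
enough, because the revenue of the price `1` is `1`. -/
lemma boundedPriors_one_revenue {H ε p : ℝ} (hH0 : 0 < H) (hε : 0 < ε) (hε1 : ε < 1)
    {D : Measure ℝ} (hD : D ∈ boundedPriors 1 H) (hp : ∃ q ∈ Ioc (0 : ℝ) 1, p = valueAt D q)
    (hbest : ∀ q ∈ Ioc (0 : ℝ) 1, 3 * (ε / 5 * max q (1 / H)) < q →
      (q - 4 * (ε / 5 * max q (1 / H))) * valueAt D q ≤
        p * (quantileOf D p + ε / 5 * max (quantileOf D p) (1 / H))) :
    (1 - ε) * optRevenue D ≤ p * quantileOf D p := by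
  obtain ⟨q₀, hq₀, hp⟩ := hp
  set β : ℝ := ε / 5 with hβ
  have hβ0 : 0 < β := by positivity
  have hp1 : p ≤ H := hp ▸ valueAt_le_of_boundedPriors hD hq₀
  have hp0 : 0 ≤ p := hp ▸ valueAt_nonneg (D := D) q₀
  have hQ := quantileOf_nonneg (D := D) p
  -- the discrepancy costs the chosen price at most `β * max revenue 1`
  have hcost : p * (quantileOf D p + β * max (quantileOf D p) (1 / H)) ≤
      p * quantileOf D p + β * max (p * quantileOf D p) 1 := by
    have : p * max (quantileOf D p) (1 / H) ≤ max (p * quantileOf D p) 1 := by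
      rw [mul_max_of_nonneg _ _ hp0]
      refine max_le_max le_rfl ?_
      rw [mul_one_div, div_le_one hH0]
      exact hp1
    have := mul_le_mul_of_nonneg_left this hβ0.le
    linarith
  have hbig : ∀ q ∈ Ioc (0 : ℝ) 1, 1 ≤ q * valueAt D q →
      (1 - ε) * (q * valueAt D q) ≤ p * quantileOf D p := by
    intro q hq hq1
    have hqH : 1 / H ≤ q := by
      rw [div_le_iff₀ hH0]
      exact hq1.trans (mul_le_mul_of_nonneg_left (valueAt_le_of_boundedPriors hD hq) hq.1.le)
    have h1 := (hbest q hq (by rw [max_eq_left hqH, hβ]; nlinarith [hq.1])).trans hcost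
    rw [max_eq_left hqH] at h1
    have h2 : (q - 4 * (β * q)) * valueAt D q = (1 - 4 * β) * (q * valueAt D q) := by ring
    rw [h2] at h1
    have h3 : β * max (p * quantileOf D p) 1 ≤ β * max (p * quantileOf D p) (q * valueAt D q) := by
      gcongr
    have h4 : ε * (q * valueAt D q) = 5 * (β * (q * valueAt D q)) := by
      rw [hβ]
      ring
    rcases le_total (p * quantileOf D p) (q * valueAt D q) with h | h
    · rw [max_eq_right h] at h3
      linarith
    · have : ε * (q * valueAt D q) ≥ 0 := by positivity
      linarith
  have hone : 1 ≤ 1 * valueAt D 1 := by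
    rw [one_mul]
    exact le_valueAt_of_boundedPriors hD zero_le_one
  refine mul_optRevenue_le hD.1 (by linarith) fun q h0 h1 => ?_
  rcases le_total 1 (q * valueAt D q) with h | h
  · exact hbig q ⟨h0, h1⟩ h
  · exact le_trans (mul_le_mul_of_nonneg_left (h.trans hone) (by linarith))
      (hbig 1 ⟨one_pos, le_rfl⟩ hone)

/-- For values in `[1, H]` a discrepancy of `ε / 5 * max q (1 / H)` at the quantile `q` costs at
most a factor `1 - ε`. With windows of width about `Δ₁ = max Δ (ε / √H)`, numbered from the top of
the support, it takes about `Δ₁ * H / (ε ^ 2 * (j + 1))` samples in the window `j`. -/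
lemma learnable_boundedPriors_one {H ε Δ δ : ℝ} (hH : 1 ≤ H) (hε : 0 < ε) (hε1 : ε < 1)
    (hΔ1 : Δ < 1) (hδ : 0 < δ) (hδ1 : δ < 1) :
    ∃ m : ℕ, (m : ℝ) ≤ 1052521 *
        (1 + Real.log H + Real.log (1 / ε) + Real.log (1 / δ)) ^ 2 *
        max (Real.sqrt H / ε) (Δ * H / ε ^ 2) ∧
      Learnable (boundedPriors 1 H) (fun D => (1 - ε) * optRevenue D) Δ δ m := by
  have hH0 : 0 < H := by linarith
  have hsH : 1 ≤ Real.sqrt H := Real.one_le_sqrt.2 hH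
  have hsq : Real.sqrt H * Real.sqrt H = H := Real.mul_self_sqrt hH0.le
  have hsHH : Real.sqrt H ≤ H := by nlinarith
  set d : ℝ := max Δ (ε / Real.sqrt H) with hd
  have hd0 : 0 < d := lt_max_of_lt_right (by positivity)
  obtain ⟨K, hK, hK1, hK2⟩ := exists_window_count hd0 (max_lt hΔ1 (by
    rw [div_lt_one (by linarith)]
    linarith))
  have hK0 : (0 : ℝ) < K := by exact_mod_cast hK
  set β : ℝ := ε / 5 with hβ
  have hβ0 : 0 < β := by positivity
  set j₀ : ℝ := K / H with hj₀
  have hj₀0 : 0 < j₀ := by positivity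
  let X : Fin K → ℝ := fun j => 1 + 2 / (β ^ 2 * j₀ * (j + 1))
  -- Relative precision below the quantile `1 / K` is needed in the first window only, and there
  -- only if it reaches beyond `1 / H`. Elsewhere `β * max j j₀` is a lower bound for the precision, in
  -- units of the window width, and precision `1` is trivial.
  let top : Fin K → Prop := fun j => (j : ℕ) = 0 ∧ j₀ ≤ 1
  let α : Fin K → ℝ := fun j => open Classical in
    if top j then β else min 1 (β * max ((j : ℕ) : ℝ) j₀)
  let σ : Fin K → ℝ := fun j => open Classical in if top j then j₀ else 1
  have hJ : ∀ j : Fin K, ¬ top j → 1 ≤ max ((j : ℕ) : ℝ) j₀ := by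
    intro j hj
    by_cases h : (j : ℕ) = 0
    · exact le_max_of_le_right (not_le.1 fun h' => hj ⟨h, h'⟩).le
    · exact le_max_of_le_left (by exact_mod_cast Nat.one_le_iff_ne_zero.2 h)
  set M : ℝ := max (Real.sqrt H / ε) (Δ * H / ε ^ 2) with hM
  have hMd : d * H / ε ^ 2 = M := by
    have h1 : Real.sqrt H / ε = ε / Real.sqrt H * H / ε ^ 2 := by
      nth_rewrite 3 [← hsq]
      field_simp
    rw [hM, h1, max_comm, max_div_div_right (by positivity), ← max_mul_of_nonneg _ _ hH0.le]
  set T : ℝ := 1 + Real.log H + Real.log (1 / ε) + Real.log (1 / δ) with hT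
  have hlH : 0 ≤ Real.log H := Real.log_nonneg hH
  have hlε : 0 ≤ Real.log (1 / ε) := Real.log_nonneg ((one_le_div hε).2 hε1.le)
  have hlδ : 0 ≤ Real.log (1 / δ) := Real.log_nonneg ((one_le_div hδ).2 hδ1.le)
  have hT0 : 0 ≤ T := by positivity
  have hKH : K ≤ Real.sqrt H / ε := by
    rw [le_div_iff₀ hε]
    have : ε / Real.sqrt H * K ≤ 1 := le_trans (by gcongr; exact le_max_right _ _) hK1
    rw [div_mul_eq_mul_div, div_le_one (by linarith)] at this
    linarith
  have hlogK : 1 + Real.log K ≤ T := by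
    have h1 : (K : ℝ) ≤ H * (1 / ε) := hKH.trans (by rw [mul_one_div]; gcongr)
    have h2 := Real.log_le_log hK0 h1
    rw [Real.log_mul (by positivity) (by positivity)] at h2
    linarith
  set L : ℝ := Real.log (12 * K * (1 + 2 / (β ^ 2 * j₀)) / δ) with hL
  have hLT : L ≤ 613 * T := by
    have h1 : K * (1 + 2 / (β ^ 2 * j₀)) ≤ 51 * H / ε ^ 2 := by
      have h2 : K * (2 / (β ^ 2 * j₀)) = 50 * H / ε ^ 2 := by
        rw [hβ, hj₀]
        field_simp
        norm_num
      have h3 : Real.sqrt H / ε ≤ H / ε ^ 2 := by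
        rw [div_le_div_iff₀ hε (by positivity)]
        nlinarith [mul_le_mul hsHH hε1.le hε.le hH0.le]
      have h4 : 51 * H / ε ^ 2 = H / ε ^ 2 + 50 * H / ε ^ 2 := by ring
      rw [mul_add, mul_one, h2, h4]
      linarith
    have h2 : 12 * K * (1 + 2 / (β ^ 2 * j₀)) / δ ≤ 612 * H * (1 / ε) * (1 / ε) * (1 / δ) := by
      calc _ = 12 * (K * (1 + 2 / (β ^ 2 * j₀))) / δ := by ring
        _ ≤ 12 * (51 * H / ε ^ 2) / δ := by gcongr
        _ = _ := by field_simp; norm_num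
    have h3 := Real.log_le_log (by positivity) h2
    rw [Real.log_mul (by positivity) (by positivity), Real.log_mul (by positivity) (by positivity),
      Real.log_mul (by positivity) (by positivity), Real.log_mul (by positivity) (by positivity)]
      at h3
    have h4 := Real.log_le_sub_one_of_pos (by norm_num : (0 : ℝ) < 612)
    linarith
  have hX1 : ∀ j, 1 ≤ X j := fun j => by
    have : 0 ≤ 2 / (β ^ 2 * j₀ * (((j : ℕ) : ℝ) + 1)) := by positivity
    simp only [X]
    linarith
  have harg : ∀ j, 3 ≤ 12 * K * X j / δ := by
    intro j
    rw [le_div_iff₀ hδ]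
    have : (1 : ℝ) ≤ K := by exact_mod_cast hK
    nlinarith [hX1 j]
  have hLj : ∀ j, Real.log (12 * K * X j / δ) ≤ L := by
    intro j
    refine Real.log_le_log (by linarith [harg j]) ?_
    simp only [X]
    gcongr 12 * K * (1 + 2 / ?_) / δ
    exact le_mul_of_one_le_right (by positivity)
      (by linarith [Nat.cast_nonneg (α := ℝ) (j : ℕ)])
  have hNpos : ∀ j, 0 < ⌈16 * X j * Real.log (12 * K * X j / δ)⌉₊ := fun j =>
    Nat.ceil_pos.2 (mul_pos (by linarith [hX1 j]) (by linarith [one_le_log (harg j)]))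
  refine ⟨∑ j, ⌈16 * X j * Real.log (12 * K * X j / δ)⌉₊, ?_, learnable_of_stratified hK (n := K)
    (α := α) (σ := σ) (X := X) (e := fun q => β * max q (1 / H))
    ?_ (fun j => ?_) (fun j => ?_) (fun j => ?_) (fun j => ?_)
    (fun j => ?_) hδ le_rfl hNpos (fun _ => Nat.le_ceil _)
    (fun j s hs => ?_) (fun a b hab => by simp only; gcongr) (fun q => by positivity)
    (fun D hD => hD.1) fun D hD p hp hbest => ?_⟩
  · have hsum : ∑ j, X j ≤ 101 * M * T := by
      have h1 : ∑ j, X j = K + 2 / (β ^ 2 * j₀) * (harmonic K : ℝ) := by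
        simp only [X]
        rw [Finset.sum_add_distrib, Fin.sum_univ_eq_sum_range
          (fun j : ℕ => 2 / (β ^ 2 * j₀ * ((j : ℝ) + 1))) K, harmonic]
        push_cast
        rw [Finset.mul_sum]
        simp only [Finset.sum_const, Finset.card_univ, Fintype.card_fin, nsmul_eq_mul, mul_one]
        congr 1
        refine Finset.sum_congr rfl fun i _ => ?_
        rw [← div_eq_mul_inv, div_div]
      have h2 := harmonic_le_one_add_log K
      have h3 : 2 / (β ^ 2 * j₀) ≤ 100 * M := by
        rw [← hMd, hβ, hj₀, div_le_iff₀ (by positivity)]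
        have : 100 * (d * H / ε ^ 2) * ((ε / 5) ^ 2 * (K / H)) = 2 * (2 * d * K) := by
          field_simp
          norm_num
        rw [this]
        linarith
      have h4 : (K : ℝ) ≤ M := hKH.trans (le_max_left _ _)
      have h5 : 1 ≤ T := by linarith
      calc ∑ j, X j ≤ M + 100 * M * T := by
            rw [h1]
            have hh : (0 : ℝ) ≤ harmonic K := by
              exact_mod_cast (Finset.sum_nonneg fun _ _ => by positivity : 0 ≤ harmonic K)
            exact add_le_add h4 (mul_le_mul h3 (h2.trans hlogK) hh (by
              linarith [(by positivity : 0 ≤ 2 / (β ^ 2 * j₀))]))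
        _ ≤ 101 * M * T := by nlinarith
    push_cast
    calc ∑ j, (⌈16 * X j * Real.log (12 * K * X j / δ)⌉₊ : ℝ) ≤ ∑ j, X j * (17 * L) := by
          refine Finset.sum_le_sum fun j _ => (ceil_le_of_one_le (hX1 j)
            (one_le_log (harg j))).trans ?_
          have := mul_le_mul_of_nonneg_left (hLj j) (by linarith [hX1 j] : 0 ≤ 17 * X j)
          linarith
      _ = (∑ j, X j) * (17 * L) := by rw [Finset.sum_mul]
      _ ≤ (101 * M * T) * (17 * (613 * T)) := by
          have hL0 : 0 ≤ L := by linarith [one_le_log (harg ⟨0, hK⟩), hLj ⟨0, hK⟩]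
          have hM0 : 0 ≤ M := le_max_of_le_left (by positivity)
          gcongr
      _ = 1052521 * T ^ 2 * M := by ring
  · rw [le_div_iff₀ hK0]
    exact le_trans (by gcongr; exact le_max_left _ _) hK1
  · simp only [α]
    split_ifs
    · exact hβ0
    · exact lt_min one_pos (mul_pos hβ0 (lt_max_of_lt_right hj₀0))
  · simp only [α]
    split_ifs
    · linarith
    · exact min_le_left _ _
  · simp only [σ]
    split_ifs
    · exact hj₀0
    · exact one_pos
  · simp only [σ]
    split_ifs with h
    · exact h.2
    · exact le_rfl
  · simp only [α, σ]
    split_ifs with h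
    · have : X j * (β ^ 2 * j₀) = β ^ 2 * j₀ + 2 := by
        simp only [X, h.1]
        field_simp
        norm_num
      rw [this]
      have : 0 < β ^ 2 * j₀ := by positivity
      linarith
    · set J := max ((j : ℕ) : ℝ) j₀ with hJdef
      have hJ1 := hJ j h
      rw [mul_one]
      rcases le_total 1 (β * J) with h' | h'
      · rw [min_eq_left h']
        linarith [hX1 j]
      · rw [min_eq_right h']
        have h1 : 2 / (β ^ 2 * j₀ * (((j : ℕ) : ℝ) + 1)) * (β * J) ^ 2 =
            2 * J * J / (j₀ * (((j : ℕ) : ℝ) + 1)) := by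
          field_simp
        have h2 : 1 ≤ 2 * J * J / (j₀ * (((j : ℕ) : ℝ) + 1)) := by
          rw [one_le_div (by positivity), mul_comm]
          exact mul_le_mul (by linarith [le_max_left ((j : ℕ) : ℝ) j₀]) (le_max_right _ _)
            hj₀0.le (by positivity)
        have h3 : X j * (β * J) ^ 2 = (β * J) ^ 2 +
            2 / (β ^ 2 * j₀ * (((j : ℕ) : ℝ) + 1)) * (β * J) ^ 2 := by
          simp only [X]
          ring
        rw [h3, h1]
        have := sq_nonneg (β * J)
        linarith
  · have hR : K * (β * max (((j : ℕ) + s) / K) (1 / H)) = β * max ((j : ℕ) + s) j₀ := by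
      rw [mul_left_comm, mul_max_of_nonneg _ _ hK0.le, mul_div_cancel₀ _ hK0.ne', mul_one_div]
    simp only [α, σ]
    rw [hR]
    split_ifs with h
    · simp [h.1]
    · rw [max_eq_right hs.2, mul_one]
      refine (min_le_right _ _).trans ?_
      gcongr
      linarith [hs.1]
  · exact boundedPriors_one_revenue hH0 hε hε1 hD hp hbest

/-! ### Estimating the value at a quantile -/

section RankedValue

variable {N : ℕ} [Nonempty (Fin N)]

/-- The largest of the nonnegative answers `z j` that at least `θ` answers reach, and `0` if
there is none. -/
noncomputable def rankedValue (θ : ℝ) (z : Fin N → ℝ) : ℝ :=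
  Finset.univ.sup' Finset.univ_nonempty fun j =>
    if θ ≤ ∑ i, (if z j ≤ z i then (1 : ℝ) else 0) then z j else 0

lemma le_rankedValue {θ v : ℝ} {z : Fin N → ℝ} (hθ : 0 < θ)
    (h : θ ≤ ((Finset.univ.filter fun j => v ≤ z j).card : ℝ)) : v ≤ rankedValue θ z := by
  have hne : (Finset.univ.filter fun j => v ≤ z j).Nonempty := by
    rw [← Finset.card_pos]
    exact_mod_cast hθ.trans_le h
  obtain ⟨j, hj, hmin⟩ := Finset.exists_min_image _ z hne
  have hvj := (Finset.mem_filter.1 hj).2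
  have hrank : θ ≤ ∑ i, (if z j ≤ z i then (1 : ℝ) else 0) := by
    refine h.trans ?_
    rw [Finset.sum_boole]
    exact_mod_cast Finset.card_le_card fun i hi =>
      Finset.mem_filter.2 ⟨Finset.mem_univ _, hmin i hi⟩
  have := Finset.le_sup' (f := fun j => if θ ≤ ∑ i, (if z j ≤ z i then (1 : ℝ) else 0) then z j
    else 0) (Finset.mem_univ j)
  simp only [if_pos hrank] at this
  exact hvj.trans this

lemma rankedValue_le {θ v : ℝ} {z : Fin N → ℝ} (hv : 0 ≤ v)
    (h : ((Finset.univ.filter fun j => v < z j).card : ℝ) < θ) : rankedValue θ z ≤ v := by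
  refine Finset.sup'_le _ _ fun j _ => ?_
  split_ifs with hj
  · by_contra! hlt
    refine absurd (hj.trans ?_) (not_le.2 h)
    rw [Finset.sum_boole]
    exact_mod_cast Finset.card_le_card fun i hi =>
      Finset.mem_filter.2 ⟨Finset.mem_univ _, hlt.trans_le (Finset.mem_filter.1 hi).2⟩
  · exact hv

lemma measurable_rankedValue :
    Measurable fun t : ℝ × (Fin N → ℝ) => rankedValue t.1 t.2 := by
  have : (fun t : ℝ × (Fin N → ℝ) => rankedValue t.1 t.2) =
      Finset.univ.sup' Finset.univ_nonempty fun (j : Fin N) (t : ℝ × (Fin N → ℝ)) =>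
        if t.1 ≤ ∑ i, (if t.2 j ≤ t.2 i then (1 : ℝ) else 0) then t.2 j else 0 := by
    ext t
    simp [rankedValue, Finset.sup'_apply]
  rw [this]
  have hc : ∀ i : Fin N, Measurable fun t : ℝ × (Fin N → ℝ) => t.2 i := fun i =>
    (measurable_pi_apply i).comp measurable_snd
  exact Finset.measurable_sup' _ fun j _ => Measurable.ite (measurableSet_le measurable_fst
    (Finset.measurable_sum _ fun i _ => Measurable.ite (measurableSet_le (hc j) (hc i))
      measurable_const measurable_const)) (hc j) measurable_const

end RankedValue

/-- The left end of a window of width `w` in `[0, 1]` for the quantile `x`: it is `[x - w, x]`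
if that lies in `[0, 1]`, and `[0, w]` if `x < w`. -/
noncomputable def windowLeft (w x : ℝ) : ℝ := max 0 (min (x - w) (1 - w))

/-- The number of answers, out of `N` from the window of `x`, that are expected to have a quantile
below `x`, reduced by the relative error `α`. -/
noncomputable def targetRank (N : ℕ) (α w x : ℝ) : ℝ := N * ((1 - α) * min 1 (x / w))

/-- A good block of samples from the window of `x` finds the value at `x` up to a relative error
`κ` of the quantile. -/
lemma rankedValue_mem_Icc {ι : Type*} {N : ℕ} [Nonempty (Fin N)] {D : Measure ℝ} (hD : IsPrior D)
    {φ : Fin N → ι} {u : ι → unitInterval} {α σ κ w x : ℝ} (hgood : BlockGood φ α σ u)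
    (hw : 0 < w) (hw1 : w ≤ 1) (hx : 0 < x) (hx1 : x ≤ 1) (hκ1 : κ < 1)
    (hα : 0 < α) (hα1 : α < 1) (hσ : σ ≤ min 1 (x / w))
    (hακ : 4 * (α * min 1 (x / w)) ≤ κ * (x / w)) :
    rankedValue (targetRank N α w x) (fun j => valueAt D (windowLeft w x + (u (φ j) : ℝ) * w)) ∈
      Icc (valueAt D x) (valueAt D ((1 - κ) * x)) := by
  set a := windowLeft w x with ha
  set s := min 1 (x / w) with hs
  have ha0 : 0 ≤ a := le_max_left _ _
  have ha1 : a + w ≤ 1 := by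
    rw [ha, windowLeft, max_add, min_add]
    simp [hw1]
  have hs0 : 0 < s := lt_min one_pos (by positivity)
  have hs1 : s ≤ 1 := min_le_left _ _
  have hxs : x = a + s * w := by
    rw [ha, windowLeft, min_eq_left (by linarith : x - w ≤ 1 - w), hs]
    rcases le_total w x with h | h
    · rw [max_eq_right (by linarith), min_eq_left ((one_le_div hw).2 h)]
      ring
    · rw [max_eq_left (by linarith), min_eq_right ((div_le_one hw).2 h)]
      field_simp
      ring
  have hNpos : (0 : ℝ) < N := by
    have : Nonempty (Fin N) := inferInstance
    exact_mod_cast Fin.pos_iff_nonempty.2 this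
  have hy0 : ∀ j, 0 < a + (u (φ j) : ℝ) * w := fun j => by
    have := mul_pos (hgood.1 j) hw
    linarith
  have hy1 : ∀ j, a + (u (φ j) : ℝ) * w ≤ 1 := fun j => by
    nlinarith [(u (φ j)).2.2]
  have hκx : 0 < (1 - κ) * x := mul_pos (by linarith) hx
  have hκ0 : 0 < κ * (x / w) := lt_of_lt_of_le (by positivity) hακ
  have hκ : 0 < κ := pos_of_mul_pos_left hκ0 (by positivity)
  constructor
  · refine le_rankedValue (mul_pos hNpos (mul_pos (by linarith) hs0)) ?_
    have h1 := (abs_le.1 (hgood.2 s ⟨hs0.le, hs1⟩)).1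
    rw [max_eq_left hσ] at h1
    have h2 : seedCount φ u s ≤ (Finset.univ.filter fun j =>
        valueAt D x ≤ valueAt D (a + (u (φ j) : ℝ) * w)).card := by
      refine Finset.card_le_card (Finset.monotone_filter_right _ fun j _ hj => ?_)
      refine hD.valueAt_le_valueAt (hy0 j) ?_ hx1
      rw [hxs]
      gcongr
    have h3 : (seedCount φ u s : ℝ) ≤ _ := Nat.cast_le.2 h2
    refine le_trans ?_ h3
    rw [targetRank, ← hs]
    linarith
  · refine rankedValue_le (valueAt_nonneg _) ?_
    set s' := s - κ * (x / w) with hs'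
    have h2 : (Finset.univ.filter fun j => valueAt D ((1 - κ) * x) <
        valueAt D (a + (u (φ j) : ℝ) * w)).card ≤ seedCount φ u s' := by
      refine Finset.card_le_card (Finset.monotone_filter_right _ fun j _ hj => ?_)
      have h3 : a + (u (φ j) : ℝ) * w < (1 - κ) * x := by
        by_contra! h
        exact absurd (hD.valueAt_le_valueAt hκx h (hy1 j)) (not_le.2 hj)
      have h4 : s' * w = s * w - κ * x := by
        rw [hs']
        field_simp
      refine le_of_mul_le_mul_right ?_ hw
      rw [h4]
      linarith
    refine lt_of_le_of_lt (Nat.cast_le.2 h2) ?_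
    have hrank : 0 < (1 - α) * s := mul_pos (by linarith) hs0
    rw [targetRank, ← hs]
    rcases lt_or_ge s' 0 with h | h
    · have : seedCount φ u s' = 0 := by
        rw [seedCount, Finset.card_eq_zero, Finset.filter_eq_empty_iff]
        intro j _ hj
        linarith [hgood.1 j]
      rw [this]
      simpa using mul_pos hNpos hrank
    · have hs's : s' ≤ s := by linarith
      have h1 := (abs_le.1 (hgood.2 s' ⟨h, hs's.trans hs1⟩)).2
      have h3 : N * (α * max s' σ) ≤ N * (α * s) := by
        gcongr
        exact max_le hs's hσ
      have h4 : N * s' ≤ N * (s - 4 * (α * s)) := by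
        gcongr
        linarith
      have h5 : 0 < N * (α * s) := by positivity
      nlinarith

/-! ### Noisy ternary search for the peak of a concave revenue curve -/

/-- The state of the search: the ends `l` and `r` of the current interval of quantiles, and the
best candidate so far, given by its estimated revenue and its price. -/
abbrev SearchState := ℝ × ℝ × ℝ × ℝ

/-- The three quantiles that divide the current interval, the right end left out, into thirds. -/
noncomputable def thirdPoint (s : SearchState) (p : Fin 3) : ℝ :=
  s.1 + (p : ℕ) / 3 * (s.2.1 - s.1)

/-- Replace the candidate `b` by the price `z` with estimated revenue `x * z` if that is larger. -/
noncomputable def keepBetter (b : ℝ × ℝ) (x z : ℝ) : ℝ × ℝ := if b.1 ≤ x * z then (x * z, z) else b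

/-- One round of the search, where `z p` is the estimate of the value at `thirdPoint s p`: the first
or the last third of the interval is dropped, on the side of the smaller estimated revenue. -/
noncomputable def ternaryStep (s : SearchState) (z : Fin 3 → ℝ) : SearchState :=
  let x := thirdPoint s
  let b := keepBetter (keepBetter (keepBetter s.2.2 (x 0) (z 0)) (x 1) (z 1)) (x 2) (z 2)
  if x 1 * z 1 ≤ x 2 * z 2 then (x 1, s.2.1, b) else (s.1, x 2, b)

lemma le_keepBetter_left (b : ℝ × ℝ) (x z : ℝ) : b.1 ≤ (keepBetter b x z).1 := by
  rw [keepBetter]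
  split_ifs with h
  exacts [h, le_rfl]

lemma le_keepBetter_right (b : ℝ × ℝ) (x z : ℝ) : x * z ≤ (keepBetter b x z).1 := by
  rw [keepBetter]
  split_ifs with h
  exacts [le_rfl, (not_le.1 h).le]

/-- The price of the candidate `b` earns nearly its estimated revenue. -/
def CandidateSound (D : Measure ℝ) (κ : ℝ) (b : ℝ × ℝ) : Prop :=
  0 ≤ b.2 ∧ (1 - κ) * b.1 ≤ b.2 * quantileOf D b.2

lemma CandidateSound.keepBetter {D : Measure ℝ} (hD : IsPrior D) {κ x z : ℝ} {b : ℝ × ℝ}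
    (hb : CandidateSound D κ b) (hx : 0 < x) (hx1 : x ≤ 1) (hκ : 0 < κ) (hκ1 : κ < 1)
    (hz : z ∈ Icc (valueAt D x) (valueAt D ((1 - κ) * x))) :
    CandidateSound D κ (keepBetter b x z) := by
  rw [_root_.keepBetter]
  split_ifs
  · have hz0 : 0 ≤ z := (valueAt_nonneg x).trans hz.1
    have h1 : (1 - κ) * x ≤ quantileOf D z :=
      (hD.le_valueAt_iff (mul_pos (by linarith) hx) (by nlinarith) hz0).1 hz.2
    refine ⟨hz0, ?_⟩
    simp only
    nlinarith
  · exact hb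

/-- The invariant of the search: every quantile in `[c, 1]` either lies in the current interval, or
earns hardly more than the best candidate is estimated to earn. -/
structure SearchInvariant (D : Measure ℝ) (c κ : ℝ) (s : SearchState) : Prop where
  left : c ≤ s.1
  le : s.1 ≤ s.2.1
  right : s.2.1 ≤ 1
  sound : CandidateSound D κ s.2.2
  cover : ∀ q ∈ Icc c 1, q ∈ Icc s.1 s.2.1 ∨ (1 - 6 * κ) * (q * valueAt D q) ≤ s.2.2.1

lemma IsRegularPrior.chord_le {D : Measure ℝ} (hreg : IsRegularPrior D) {a b d : ℝ} (ha : 0 < a)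
    (hab : a ≤ b) (hbd : b ≤ d) (hd : d ≤ 1) :
    (d - b) * (a * valueAt D a) + (b - a) * (d * valueAt D d) ≤ (d - a) * (b * valueAt D b) := by
  rcases (hab.trans hbd).eq_or_lt with h | h
  · obtain rfl : a = b := le_antisymm hab (h ▸ hbd)
    obtain rfl : a = d := h
    simp
  have hda : 0 < d - a := by linarith
  have hw1 : 0 ≤ (d - b) / (d - a) := div_nonneg (by linarith) hda.le
  have hw2 : 0 ≤ (b - a) / (d - a) := div_nonneg (by linarith) hda.le
  have := hreg.2 (x := a) (y := d) ⟨ha, (hab.trans hbd).trans hd⟩ ⟨by linarith, hd⟩ hw1 hw2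
    (by field_simp; ring)
  have hb : ((d - b) / (d - a)) • a + ((b - a) / (d - a)) • d = b := by
    simp only [smul_eq_mul]
    field_simp
    ring
  simp only [hb] at this
  simp only [smul_eq_mul] at this
  calc _ = (d - a) * ((d - b) / (d - a) * (a * valueAt D a) +
        (b - a) / (d - a) * (d * valueAt D d)) := by field_simp
    _ ≤ _ := mul_le_mul_of_nonneg_left this hda.le

/-- Let `b` lie between `a` and `d`, at the distances `t` and `s` from them. If a concave curve
hardly falls from `b` to `d`, then it is not much higher at `a` than at `b`. -/
lemma le_of_chord_le {κ Ra Rb Rd s t : ℝ} (hs : 0 < s) (ht : 0 ≤ t) (hts : t ≤ 2 * s) (hκ : 0 < κ)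
    (hκ1 : 7 * κ ≤ 1) (hRb : 0 ≤ Rb) (h : s * Ra + t * Rd ≤ (s + t) * Rb)
    (hd : (1 - κ) * Rb ≤ Rd) : (1 - 6 * κ) * Ra ≤ Rb := by
  have h1 : t * ((1 - κ) * Rb) ≤ t * Rd := by gcongr
  have h2 : t * (κ * Rb) ≤ 2 * s * (κ * Rb) := by gcongr
  have h3 : Ra ≤ (1 + 2 * κ) * Rb := by
    refine le_of_mul_le_mul_left ?_ hs
    linarith
  have h4 : (1 - 6 * κ) * Ra ≤ (1 - 6 * κ) * ((1 + 2 * κ) * Rb) := by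
    refine mul_le_mul_of_nonneg_left h3 (by linarith)
  nlinarith [mul_nonneg hκ.le hRb]

/-- A round of the search preserves the invariant, shrinks the interval, and is conclusive once the
interval is short. -/
lemma SearchInvariant.step {D : Measure ℝ} (hD : IsPrior D) (hreg : IsRegularPrior D) {c κ : ℝ}
    (hc : 0 < c) (hκ : 0 < κ) (hκ1 : 7 * κ ≤ 1) {s : SearchState} (hs : SearchInvariant D c κ s)
    {z : Fin 3 → ℝ} (hz : ∀ p, z p ∈ Icc (valueAt D (thirdPoint s p))
      (valueAt D ((1 - κ) * thirdPoint s p))) :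
    SearchInvariant D c κ (ternaryStep s z) ∧
      (ternaryStep s z).2.1 - (ternaryStep s z).1 = 2 / 3 * (s.2.1 - s.1) ∧
      (s.2.1 - s.1 ≤ 6 * κ * s.2.1 →
        ∀ q ∈ Icc c 1, (1 - 6 * κ) * (q * valueAt D q) ≤ (ternaryStep s z).2.2.1) := by
  obtain ⟨hl, hlr, hr, hsound, hcover⟩ := hs
  set l := s.1 with hldef
  set r := s.2.1 with hrdef
  set x := thirdPoint s with hx
  have hx0 : x 0 = l := by simp [hx, thirdPoint, hldef]
  have hx1 : x 1 = l + 1 / 3 * (r - l) := by simp [hx, thirdPoint, hldef, hrdef]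
  have hx2 : x 2 = l + 2 / 3 * (r - l) := by simp [hx, thirdPoint, hldef, hrdef]
  set b := keepBetter (keepBetter (keepBetter s.2.2 (x 0) (z 0)) (x 1) (z 1)) (x 2) (z 2) with hb
  have hstep : ternaryStep s z =
      if x 1 * z 1 ≤ x 2 * z 2 then (x 1, r, b) else (l, x 2, b) := rfl
  have hb2 : x 2 * z 2 ≤ b.1 := le_keepBetter_right _ _ _
  have hb1 : x 1 * z 1 ≤ b.1 := (le_keepBetter_right _ _ _).trans (le_keepBetter_left _ _ _)
  have hb0 : x 0 * z 0 ≤ b.1 := ((le_keepBetter_right _ _ _).trans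
    (le_keepBetter_left _ _ _)).trans (le_keepBetter_left _ _ _)
  have hbs : s.2.2.1 ≤ b.1 := ((le_keepBetter_left _ _ _).trans
    (le_keepBetter_left _ _ _)).trans (le_keepBetter_left _ _ _)
  have hl0 : 0 < l := hc.trans_le hl
  have hκ1' : κ < 1 := by linarith
  have hbsound : CandidateSound D κ b := by
    refine ((hsound.keepBetter hD ?_ ?_ hκ hκ1' (hz 0)).keepBetter hD ?_ ?_ hκ hκ1'
      (hz 1)).keepBetter hD ?_ ?_ hκ hκ1' (hz 2) <;> simp only [hx0, hx1, hx2] <;> linarith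
  have hstepb : (ternaryStep s z).2.2 = b := by rw [hstep]; split_ifs <;> rfl
  have hR0 : ∀ q, 0 ≤ q → 0 ≤ q * valueAt D q := fun q hq => mul_nonneg hq (valueAt_nonneg q)
  -- all of a short interval earns hardly more than its left end
  have hshort : r - l ≤ 6 * κ * r →
      ∀ q ∈ Icc c 1, (1 - 6 * κ) * (q * valueAt D q) ≤ b.1 := by
    intro h q hq
    rcases hcover q hq with h' | h'
    · refine le_trans ?_ hb0
      have h1 : valueAt D q ≤ z 0 := (hD.valueAt_le_valueAt (by rw [hx0]; exact hl0)
        (by rw [hx0]; exact h'.1) hq.2).trans (hz 0).1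
      have h2 : (1 - 6 * κ) * q ≤ x 0 := by
        rw [hx0]
        have : (1 - 6 * κ) * q ≤ (1 - 6 * κ) * r :=
          mul_le_mul_of_nonneg_left h'.2 (by linarith)
        linarith
      calc (1 - 6 * κ) * (q * valueAt D q) = (1 - 6 * κ) * q * valueAt D q := by ring
        _ ≤ x 0 * z 0 := mul_le_mul h2 h1 (valueAt_nonneg q) (by rw [hx0]; exact hl0.le)
    · exact h'.trans hbs
  have hlow : ∀ p, 0 ≤ x p → x p * valueAt D (x p) ≤ x p * z p := fun p hp =>
    mul_le_mul_of_nonneg_left (hz p).1 hp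
  have hupp : ∀ p, 0 ≤ x p →
      (1 - κ) * (x p * z p) ≤ (1 - κ) * x p * valueAt D ((1 - κ) * x p) := by
    intro p hp
    rw [← mul_assoc]
    exact mul_le_mul_of_nonneg_left (hz p).2 (mul_nonneg (by linarith) hp)
  have hx1nn : 0 ≤ x 1 := by rw [hx1]; linarith
  have hx2nn : 0 ≤ x 2 := by rw [hx2]; linarith
  have hlong : ∀ q ∈ Icc c 1, q ∈ Icc (ternaryStep s z).1 (ternaryStep s z).2.1 ∨
      (1 - 6 * κ) * (q * valueAt D q) ≤ b.1 := by
    intro q hq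
    rcases le_or_gt (r - l) (6 * κ * r) with h | h
    · exact Or.inr (hshort h q hq)
    rcases hcover q hq with h' | h'
    swap
    · exact Or.inr (h'.trans hbs)
    have hq0 : 0 < q := hc.trans_le hq.1
    have hκx1 : κ * x 1 ≤ κ * r := by gcongr; rw [hx1]; linarith
    have hκx2 : κ * x 2 ≤ κ * r := by gcongr; rw [hx2]; linarith
    have hκx1' : 0 ≤ κ * x 1 := by positivity
    have hκx2' : 0 ≤ κ * x 2 := by positivity
    rw [hstep]
    split_ifs with hcmp
    · rcases le_or_gt (x 1) q with hqx | hqx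
      · exact Or.inl ⟨hqx, h'.2⟩
      right
      refine le_trans ?_ ((hlow 1 hx1nn).trans hb1)
      -- compare the curve at `q < x 1 < (1 - κ) * x 2`
      have h1 := hreg.chord_le hq0 hqx.le (by linarith : x 1 ≤ (1 - κ) * x 2) (by linarith)
      refine le_of_chord_le (s := (1 - κ) * x 2 - x 1) (t := x 1 - q)
        (Rd := (1 - κ) * x 2 * valueAt D ((1 - κ) * x 2)) (by linarith) (by linarith)
        (by linarith [h'.1]) hκ hκ1 (hR0 _ hx1nn) (by linarith) ?_
      exact (mul_le_mul_of_nonneg_left ((hlow 1 hx1nn).trans hcmp) (by linarith)).trans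
        (hupp 2 hx2nn)
    · rcases le_or_gt q (x 2) with hqx | hqx
      · exact Or.inl ⟨h'.1, hqx⟩
      right
      refine le_trans ?_ ((hlow 2 hx2nn).trans hb2)
      -- compare the curve at `(1 - κ) * x 1 < x 2 < q`
      have hpos : 0 < (1 - κ) * x 1 := mul_pos (by linarith) (by rw [hx1]; linarith)
      have h1 := hreg.chord_le hpos (by linarith : (1 - κ) * x 1 ≤ x 2) hqx.le hq.2
      refine le_of_chord_le (s := x 2 - (1 - κ) * x 1) (t := q - x 2)
        (Rd := (1 - κ) * x 1 * valueAt D ((1 - κ) * x 1)) (by linarith) (by linarith)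
        (by linarith [h'.2]) hκ hκ1 (hR0 _ hx2nn) (by linarith) ?_
      exact (mul_le_mul_of_nonneg_left ((hlow 2 hx2nn).trans (not_le.1 hcmp).le)
        (by linarith)).trans (hupp 1 hx1nn)
  refine ⟨⟨?_, ?_, ?_, by rwa [hstepb], by rwa [hstepb]⟩, ?_, by rwa [hstepb]⟩
  all_goals
    rw [hstep]
    split_ifs <;> simp only [hx1, hx2] <;> linarith

lemma measurable_thirdPoint (p : Fin 3) : Measurable fun s : SearchState => thirdPoint s p := by
  unfold thirdPoint
  fun_prop

lemma Measurable.keepBetter {α : Type*} [MeasurableSpace α] {b : α → ℝ × ℝ} {x z : α → ℝ}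
    (hb : Measurable b) (hx : Measurable x) (hz : Measurable z) :
    Measurable fun t => keepBetter (b t) (x t) (z t) :=
  Measurable.ite (measurableSet_le hb.fst (hx.mul hz)) ((hx.mul hz).prodMk hz) hb

lemma measurable_ternaryStep :
    Measurable fun t : SearchState × (Fin 3 → ℝ) => ternaryStep t.1 t.2 := by
  have hx : ∀ p, Measurable fun t : SearchState × (Fin 3 → ℝ) => thirdPoint t.1 p := fun p =>
    (measurable_thirdPoint p).comp measurable_fst
  have hz : ∀ p : Fin 3, Measurable fun t : SearchState × (Fin 3 → ℝ) => t.2 p := fun p =>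
    (measurable_pi_apply p).comp measurable_snd
  have hs : Measurable fun t : SearchState × (Fin 3 → ℝ) => t.1 := measurable_fst
  have hb := ((hs.snd.snd.keepBetter (hx 0) (hz 0)).keepBetter (hx 1) (hz 1)).keepBetter
    (hx 2) (hz 2)
  exact Measurable.ite (measurableSet_le ((hx 1).mul (hz 1)) ((hx 2).mul (hz 2)))
    ((hx 1).prodMk (hs.snd.fst.prodMk hb)) (hs.fst.prodMk ((hx 2).prodMk hb))

/-- A round of the search on its `3 * N` answers, in three blocks of `N`. -/
noncomputable def searchRound {N : ℕ} [Nonempty (Fin N)] (α w : ℝ) (s : SearchState)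
    (a : Fin (3 * N) → ℝ) : SearchState :=
  ternaryStep s fun p => rankedValue (targetRank N α w (thirdPoint s p)) fun j =>
    a (finProdFinEquiv (p, j))

lemma measurable_searchRound {N : ℕ} [Nonempty (Fin N)] (α w : ℝ) :
    Measurable fun t : SearchState × (Fin (3 * N) → ℝ) => searchRound α w t.1 t.2 := by
  have hr : Measurable (targetRank N α w) := by
    unfold targetRank
    fun_prop
  have hz : ∀ p : Fin 3, Measurable fun t : SearchState × (Fin (3 * N) → ℝ) =>
      rankedValue (targetRank N α w (thirdPoint t.1 p)) fun j : Fin N =>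
        t.2 (finProdFinEquiv (p, j)) := fun p =>
    measurable_rankedValue.comp ((hr.comp ((measurable_thirdPoint p).comp measurable_fst)).prodMk
      (measurable_pi_lambda _ fun j => (measurable_pi_apply _).comp measurable_snd))
  exact measurable_ternaryStep.comp (measurable_fst.prodMk (measurable_pi_lambda _ hz))

/-- The search learns whenever a price that competes with all quantiles in `[c, 1]` up to a factor
`1 - 7 * κ` meets the target. -/
lemma learnable_of_ternary {family : Set (Measure ℝ)} {target : Measure ℝ → ℝ}
    {Δ δ w c κ X : ℝ} {K N : ℕ} (hc : 0 < c) (hc1 : c ≤ 1) (hκ : 0 < κ) (hκ1 : 7 * κ ≤ 1)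
    (hw : κ * c ≤ w) (hw1 : w ≤ 1) (hΔ : Δ ≤ w) (hδ : 0 < δ)
    (hX : 1 ≤ X * ((κ / 4 * max 1 (c / w)) ^ 2 * min 1 (c / w))) (hNpos : 0 < N)
    (hN : 16 * X * Real.log (12 * (3 * (K + 1)) * X / δ) ≤ N) (hK : (2 / 3) ^ K ≤ 6 * κ * c)
    (hprior : ∀ D ∈ family, IsPrior D) (hreg : ∀ D ∈ family, IsRegularPrior D)
    (htarget : ∀ D ∈ family, ∀ p, (∀ q ∈ Icc c 1, (1 - 7 * κ) * (q * valueAt D q) ≤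
      p * quantileOf D p) → target D ≤ p * quantileOf D p) :
    Learnable family target Δ δ ((K + 1) * (3 * N)) := by
  have hw0 : 0 < w := (mul_pos hκ hc).trans_le hw
  -- Every `x ≥ c` has the relative position `s = min 1 (x / w) ≥ σ` in its window, and there an
  -- error of `α * s` is at most `κ / 4` times `x` in units of `w`.
  have : Nonempty (Fin N) := ⟨⟨0, hNpos⟩⟩
  set α : ℝ := κ / 4 * max 1 (c / w) with hα
  set σ : ℝ := min 1 (c / w) with hσ
  have hα0 : 0 < α := by positivity
  have hα1 : α ≤ 1 / 2 := by
    have h1 : κ * (c / w) ≤ 1 := by rwa [← mul_div_assoc, div_le_one hw0]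
    rw [hα, mul_max_of_nonneg _ _ (by positivity)]
    exact max_le (by linarith) (by linarith)
  have hσ0 : 0 < σ := lt_min one_pos (by positivity)
  obtain ⟨A, hA⟩ := exists_roundAlgorithm (Δ := Δ) (w := w) (K + 1) (3 * N) hΔ
    ((c, 1, 0, 0) : SearchState)
    (fun s j => windowLeft w (thirdPoint s (finProdFinEquiv.symm j).1)) (searchRound α w)
    (fun s => s.2.2.2)
    (fun _ _ => le_max_left _ _)
    (fun s j => by
      rw [windowLeft, max_add, min_add]
      simp [hw1])
    (fun j => by
      have := measurable_thirdPoint (finProdFinEquiv.symm j).1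
      unfold windowLeft
      fun_prop)
    (measurable_searchRound α w)
    measurable_snd.snd.snd
  let φ : Fin (K + 1) × Fin 3 → Fin N → Fin ((K + 1) * (3 * N)) := fun kp j =>
    finProdFinEquiv (kp.1, finProdFinEquiv (kp.2, j))
  have hφ : ∀ kp, (φ kp).Injective := fun kp a b hab =>
    (Prod.mk.inj (finProdFinEquiv.injective
      (Prod.mk.inj (finProdFinEquiv.injective hab)).2)).2
  refine Learnable.of_bad A {u | ∃ kp, ¬ BlockGood (φ kp) α σ u}
    (volume_real_exists_not_blockGood_le (n := 3 * (K + 1)) hφ (fun _ => hα0)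
      (fun _ => by linarith) (fun _ => hσ0) (fun _ => min_le_left _ _) (fun _ => hX) hδ
      (by positivity) (by simp [mul_comm]) fun _ => hN) fun D hD u hu => ?_
  simp only [mem_ofPred_eq, not_exists, not_not] at hu
  obtain ⟨st, h0, hst, hout⟩ := hA D u
  have hDp := hprior D hD
  have hDr := hreg D hD
  have hz : ∀ k : Fin (K + 1), SearchInvariant D c κ (st k) → ∃ z : Fin 3 → ℝ,
      st (k + 1) = ternaryStep (st k) z ∧ ∀ p, z p ∈ Icc (valueAt D (thirdPoint (st k) p))
        (valueAt D ((1 - κ) * thirdPoint (st k) p)) := by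
    intro k hinv
    refine ⟨_, hst k, fun p => ?_⟩
    simp only [Equiv.symm_apply_apply]
    have hp0 : (0 : ℝ) ≤ ((p : ℕ) : ℝ) / 3 := by positivity
    have hp1 : ((p : ℕ) : ℝ) / 3 ≤ 1 := by
      rw [div_le_one (by norm_num)]
      exact_mod_cast p.isLt.le
    have hlr := hinv.le
    have hx0 : c ≤ thirdPoint (st k) p := by
      rw [thirdPoint]
      nlinarith [hinv.left]
    have hx1 : thirdPoint (st k) p ≤ 1 := by
      rw [thirdPoint]
      nlinarith [hinv.right]
    have hxw : c / w ≤ thirdPoint (st k) p / w := by gcongr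
    refine rankedValue_mem_Icc hDp (hu (k, p)) hw0 hw1 (hc.trans_le hx0) hx1 (by linarith) hα0
      (by linarith) (min_le_min_left _ hxw) ?_
    have : max 1 (c / w) * min 1 (thirdPoint (st k) p / w) ≤ thirdPoint (st k) p / w := by
      rcases le_total 1 (c / w) with h | h
      · rw [max_eq_right h]
        exact (mul_le_of_le_one_right (by positivity) (min_le_left _ _)).trans hxw
      · rw [max_eq_left h, one_mul]
        exact min_le_right _ _
    have := mul_le_mul_of_nonneg_left this hκ.le
    rw [hα]
    linarith
  have hinv : ∀ k : ℕ, k ≤ K + 1 → SearchInvariant D c κ (st k) ∧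
      (st k).2.1 - (st k).1 = (2 / 3) ^ k * (1 - c) := by
    intro k
    induction k with
    | zero =>
      intro _
      rw [h0]
      refine ⟨⟨le_rfl, hc1, le_rfl, ⟨le_rfl, by simp⟩, fun q hq => Or.inl hq⟩, by simp⟩
    | succ k ih =>
      intro hk
      obtain ⟨h1, h2⟩ := ih (by omega)
      obtain ⟨z, hz1, hz2⟩ := hz ⟨k, by omega⟩ h1
      obtain ⟨h3, h4, -⟩ := h1.step hDp hDr hc hκ hκ1 hz2
      simp only at hz1 h3 h4
      rw [hz1]
      refine ⟨h3, ?_⟩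
      rw [h4, h2, pow_succ]
      ring
  obtain ⟨h1, h2⟩ := hinv K (by omega)
  obtain ⟨z, hz1, hz2⟩ := hz ⟨K, by omega⟩ h1
  have hlast := (h1.step hDp hDr hc hκ hκ1 hz2).2.2
  have hsound := (hinv (K + 1) le_rfl).1.sound
  simp only at hz1 hlast
  rw [← hz1] at hlast
  rw [hout, revenue_postedPrice hsound.1]
  refine htarget D hD _ fun q hq => le_trans ?_ hsound.2
  have hshort : (st K).2.1 - (st K).1 ≤ 6 * κ * (st K).2.1 := by
    rw [h2]
    have hcr : c ≤ (st K).2.1 := h1.left.trans h1.le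
    have h3 : (2 / 3 : ℝ) ^ K * (1 - c) ≤ (2 / 3) ^ K := mul_le_of_le_one_right (by positivity)
      (by linarith)
    have h4 : 6 * κ * c ≤ 6 * κ * (st K).2.1 := by gcongr
    linarith
  have h5 := mul_le_mul_of_nonneg_left (hlast hshort q hq) (by linarith : 0 ≤ 1 - κ)
  refine le_trans ?_ h5
  have hR : 0 ≤ q * valueAt D q := mul_nonneg (hc.le.trans hq.1) (valueAt_nonneg q)
  nlinarith [mul_nonneg (sq_nonneg κ) hR]

/-- The number of samples of the search with windows of width `w`: `O(log (1 / (κ * c)))` rounds of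
three blocks, whose size is set by the precision `κ` at the smallest quantile `c`. -/
lemma learnable_of_ternary_card_le {family : Set (Measure ℝ)} {target : Measure ℝ → ℝ}
    {Δ δ w c κ A T : ℝ} (hc : 0 < c) (hc1 : c ≤ 1) (hκ : 0 < κ) (hκ1 : 7 * κ ≤ 1)
    (hw : κ * c ≤ w) (hw1 : w ≤ 1) (hΔ : Δ ≤ w) (hδ : 0 < δ) (hδ1 : δ < 1)
    (hT : 1 ≤ T) (hA : Real.log (1 / (κ * c)) ≤ A * T) (hδT : Real.log (1 / δ) ≤ T)
    (hprior : ∀ D ∈ family, IsPrior D) (hreg : ∀ D ∈ family, IsRegularPrior D)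
    (htarget : ∀ D ∈ family, ∀ p, (∀ q ∈ Icc c 1, (1 - 7 * κ) * (q * valueAt D q) ≤
      p * quantileOf D p) → target D ≤ p * quantileOf D p) :
    ∃ m : ℕ, (m : ℝ) ≤ 51 * (2 + 3 * A) * (577 + 5 * A) * T ^ 2 *
        (16 / κ ^ 2 * min (w / c) ((w / c) ^ 2)) ∧
      Learnable family target Δ δ m := by
  have hκc : 0 < κ * c := mul_pos hκ hc
  have hw0 : 0 < w := hκc.trans_le hw
  have hκc1 : κ * c ≤ 1 := hw.trans hw1
  set ℓ : ℝ := Real.log (1 / (κ * c)) with hℓ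
  have hℓ0 : 0 ≤ ℓ := Real.log_nonneg ((one_le_div hκc).2 hκc1)
  have hlδ : 0 ≤ Real.log (1 / δ) := Real.log_nonneg ((one_le_div hδ).2 hδ1.le)
  set X : ℝ := 16 / κ ^ 2 * min (w / c) ((w / c) ^ 2) with hX
  have hXeq : X * ((κ / 4 * max 1 (c / w)) ^ 2 * min 1 (c / w)) = 1 := by
    rcases le_total c w with h | h
    · have h1 : c / w ≤ 1 := (div_le_one hw0).2 h
      have h2 : 1 ≤ w / c := (one_le_div hc).2 h
      rw [hX, max_eq_left h1, min_eq_right h1, min_eq_left (by nlinarith)]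
      field_simp
      norm_num
    · have h1 : 1 ≤ c / w := (one_le_div hw0).2 h
      have h2 : w / c ≤ 1 := (div_le_one hc).2 h
      have h3 : 0 < w / c := by positivity
      rw [hX, max_eq_right h1, min_eq_left h1, min_eq_right (by nlinarith)]
      field_simp
      norm_num
  have hX1 : 1 ≤ X := by
    have h1 : κ ≤ w / c := (le_div_iff₀ hc).2 hw
    have h2 : κ ^ 2 ≤ min (w / c) ((w / c) ^ 2) := le_min (by nlinarith) (by gcongr)
    have h3 : (1 : ℝ) ≤ 16 / κ ^ 2 * κ ^ 2 := by
      rw [div_mul_cancel₀ _ (by positivity)]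
      norm_num
    exact h3.trans (mul_le_mul_of_nonneg_left h2 (by positivity))
  have hXle : X ≤ 16 * ((1 / (κ * c)) * (1 / (κ * c))) := by
    have h1 : min (w / c) ((w / c) ^ 2) ≤ (1 / c) ^ 2 :=
      (min_le_right _ _).trans (by gcongr)
    calc X ≤ 16 / κ ^ 2 * (1 / c) ^ 2 := mul_le_mul_of_nonneg_left h1 (by positivity)
      _ = _ := by field_simp
  obtain ⟨K, hKdef⟩ : ∃ K : ℕ, K = ⌈3 * ℓ⌉₊ := ⟨_, rfl⟩
  have hK1 : 3 * ℓ ≤ K := hKdef ▸ Nat.le_ceil _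
  have hK2 : (K : ℝ) ≤ 3 * ℓ + 1 := hKdef ▸ (Nat.ceil_lt_add_one (by positivity)).le
  have hKpow : (2 / 3 : ℝ) ^ K ≤ 6 * κ * c := by
    have h1 : (2 / 3 : ℝ) ≤ Real.exp (-(1 / 3)) := by
      linarith [Real.add_one_le_exp (-(1 / 3 : ℝ))]
    calc (2 / 3 : ℝ) ^ K ≤ Real.exp (-(1 / 3)) ^ K := by gcongr
      _ = Real.exp (-(K / 3)) := by rw [← Real.exp_nat_mul]; ring_nf
      _ ≤ Real.exp (-ℓ) := Real.exp_le_exp.2 (by linarith)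
      _ = κ * c := by rw [hℓ, one_div, Real.log_inv, neg_neg, Real.exp_log hκc]
      _ ≤ 6 * κ * c := by linarith
  set L : ℝ := Real.log (12 * (3 * (K + 1)) * X / δ) with hL
  have harg : 3 ≤ 12 * (3 * (K + 1)) * X / δ := by
    rw [le_div_iff₀ hδ]
    nlinarith [Nat.cast_nonneg (α := ℝ) K]
  have hL1 : 1 ≤ L := one_le_log harg
  have hLT : L ≤ (577 + 5 * A) * T := by
    have h1 : 12 * (3 * (K + 1)) * X / δ ≤
        576 * (K + 1) * (1 / (κ * c)) * (1 / (κ * c)) * (1 / δ) := by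
      calc _ ≤ 12 * (3 * (K + 1)) * (16 * ((1 / (κ * c)) * (1 / (κ * c)))) / δ := by gcongr
        _ = _ := by ring
    have h2 := Real.log_le_log (by linarith) h1
    rw [Real.log_mul (by positivity) (by positivity), Real.log_mul (by positivity) (by positivity),
      Real.log_mul (by positivity) (by positivity), Real.log_mul (by positivity) (by positivity)]
      at h2
    have h3 := Real.log_le_sub_one_of_pos (by norm_num : (0 : ℝ) < 576)
    have h4 := Real.log_le_sub_one_of_pos (by positivity : (0 : ℝ) < K + 1)
    linarith
  refine ⟨(K + 1) * (3 * ⌈16 * X * L⌉₊), ?_, learnable_of_ternary hc hc1 hκ hκ1 hw hw1 hΔ hδ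
    hXeq.ge (Nat.ceil_pos.2 (by positivity)) (Nat.le_ceil _) hKpow hprior hreg htarget⟩
  have hKT : (K : ℝ) + 1 ≤ (2 + 3 * A) * T := by linarith
  push_cast
  calc ((K : ℝ) + 1) * (3 * ⌈16 * X * L⌉₊) ≤ ((2 + 3 * A) * T) * (3 * (17 * X * L)) := by
        have := ceil_le_of_one_le hX1 hL1
        exact mul_le_mul hKT (by linarith) (by positivity)
          ((by positivity : (0 : ℝ) ≤ K + 1).trans hKT)
    _ = ((2 + 3 * A) * T * 51 * X) * L := by ring
    _ ≤ ((2 + 3 * A) * T * 51 * X) * ((577 + 5 * A) * T) := by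
        have : 0 ≤ (2 + 3 * A) * T := (by positivity : (0 : ℝ) ≤ K + 1).trans hKT
        gcongr
    _ = _ := by ring

/-! ### Sample complexities -/

/-- The search on `[ε / 2, 1]` is enough for a regular prior: by concavity, the quantile `ε / 2`
loses at most a factor `1 - ε / 2` against any smaller one. -/
lemma learnable_regularPriors {ε Δ δ : ℝ} (hε : 0 < ε) (hε1 : ε < 1) (hΔ : 0 < Δ)
    (hΔ1 : Δ < 1) (hδ : 0 < δ) (hδ1 : δ < 1) :
    ∃ m : ℕ, (m : ℝ) ≤ 51 * (2 + 3 * 29) * (577 + 5 * 29) * 12544 *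
        (1 + Real.log (1 / ε) + Real.log (1 / δ)) ^ 2 *
        max 1 (min (Δ ^ 2 / ε ^ 4) (Δ / ε ^ 3)) ∧
      Learnable regularPriors (fun D => (1 - ε) * optRevenue D) Δ δ m := by
  have hlε : 0 ≤ Real.log (1 / ε) := Real.log_nonneg ((one_le_div hε).2 hε1.le)
  have hlδ : 0 ≤ Real.log (1 / δ) := Real.log_nonneg ((one_le_div hδ).2 hδ1.le)
  set T : ℝ := 1 + Real.log (1 / ε) + Real.log (1 / δ) with hT
  have hlog : Real.log (1 / (ε / 14 * (ε / 2))) ≤ 29 * T := by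
    have h1 : 1 / (ε / 14 * (ε / 2)) = 28 * (1 / ε) * (1 / ε) := by
      field_simp
      norm_num
    rw [h1, Real.log_mul (by positivity) (by positivity), Real.log_mul (by positivity)
      (by positivity)]
    linarith [Real.log_le_sub_one_of_pos (by norm_num : (0 : ℝ) < 28)]
  obtain ⟨m, hm, hlearn⟩ := learnable_of_ternary_card_le (family := regularPriors)
    (target := fun D => (1 - ε) * optRevenue D) (Δ := Δ) (w := max Δ (ε / 14 * (ε / 2)))
    (c := ε / 2) (κ := ε / 14) (A := 29) (T := T) (by positivity) (by linarith) (by positivity)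
    (by linarith) (le_max_right _ _) (max_le hΔ1.le (by nlinarith)) (le_max_left _ _) hδ hδ1
    (by linarith) hlog (by linarith) (fun D hD => hD.1) (fun D hD => hD.2)
    (fun D hD p hp => by
      refine mul_optRevenue_le hD.1 (by linarith) fun q h0 h1 => ?_
      have hR : 0 ≤ q * valueAt D q := mul_nonneg h0.le (valueAt_nonneg q)
      rcases le_total (ε / 2) q with h | h
      · refine le_trans ?_ (hp q ⟨h, h1⟩)
        exact mul_le_mul_of_nonneg_right (by linarith) hR
      · refine le_trans ?_ (hp (ε / 2) ⟨le_rfl, by linarith⟩)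
        have h2 := hD.2.le_revenue_of_le h0 h (by linarith)
        have h3 := mul_le_mul_of_nonneg_left h2 (by linarith : 0 ≤ 1 - 7 * (ε / 14))
        refine le_trans ?_ h3
        nlinarith [mul_nonneg (sq_nonneg ε) hR])
  refine ⟨m, hm.trans ?_, hlearn⟩
  have hX : 16 / (ε / 14) ^ 2 * min (max Δ (ε / 14 * (ε / 2)) / (ε / 2))
      ((max Δ (ε / 14 * (ε / 2)) / (ε / 2)) ^ 2) ≤
      12544 * max 1 (min (Δ ^ 2 / ε ^ 4) (Δ / ε ^ 3)) := by
    rcases le_total Δ (ε / 14 * (ε / 2)) with h | h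
    · rw [max_eq_right h, mul_div_cancel_right₀ _ (by positivity)]
      calc _ ≤ 16 / (ε / 14) ^ 2 * (ε / 14) ^ 2 := by gcongr; exact min_le_right _ _
        _ = 16 := div_mul_cancel₀ _ (by positivity)
        _ ≤ 12544 * 1 := by norm_num
        _ ≤ _ := by gcongr; exact le_max_left _ _
    · rw [max_eq_left h]
      calc _ ≤ 12544 * min (Δ ^ 2 / ε ^ 4) (Δ / ε ^ 3) := by
            rw [mul_min_of_nonneg _ _ (by positivity : (0 : ℝ) ≤ 12544), min_comm,
              mul_min_of_nonneg _ _ (by positivity : 0 ≤ 16 / (ε / 14) ^ 2)]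
            refine min_le_min (le_of_eq ?_) ?_
            · field_simp
              norm_num
            · have : 16 / (ε / 14) ^ 2 * (Δ / (ε / 2)) = 6272 * (Δ / ε ^ 3) := by
                field_simp
                norm_num
              rw [this]
              gcongr
              norm_num
        _ ≤ _ := by gcongr; exact le_max_right _ _
  calc _ ≤ 51 * (2 + 3 * 29) * (577 + 5 * 29) * T ^ 2 *
        (12544 * max 1 (min (Δ ^ 2 / ε ^ 4) (Δ / ε ^ 3))) := by gcongr
    _ = _ := by ring

/-- The search on `[exp (-1), 1]` is enough for an MHR prior. -/
lemma learnable_mhrPriors {ε Δ δ : ℝ} (hε : 0 < ε) (hε1 : ε < 1) (hΔ : 0 < Δ)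
    (hΔ1 : Δ < 1) (hδ : 0 < δ) (hδ1 : δ < 1) :
    ∃ m : ℕ, (m : ℝ) ≤ 51 * (2 + 3 * 8) * (577 + 5 * 8) * 7056 *
        (1 + Real.log (1 / ε) + Real.log (1 / δ)) ^ 2 * max 1 (Δ ^ 2 / ε ^ 2) ∧
      Learnable mhrPriors (fun D => (1 - ε) * optRevenue D) Δ δ m := by
  have hlε : 0 ≤ Real.log (1 / ε) := Real.log_nonneg ((one_le_div hε).2 hε1.le)
  have hlδ : 0 ≤ Real.log (1 / δ) := Real.log_nonneg ((one_le_div hδ).2 hδ1.le)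
  set T : ℝ := 1 + Real.log (1 / ε) + Real.log (1 / δ) with hT
  set c : ℝ := Real.exp (-1) with hc
  have hc0 : 0 < c := Real.exp_pos _
  have hc1 : c ≤ 1 := by simp [hc]
  have hcinv : 1 / c ≤ 3 := by
    rw [hc, Real.exp_neg, one_div, inv_inv]
    exact Real.exp_one_lt_three.le
  have hlog : Real.log (1 / (ε / 7 * c)) ≤ 8 * T := by
    have h1 : 1 / (ε / 7 * c) = 7 * (1 / ε) * (1 / c) := by field_simp
    have h2 : Real.log (1 / c) = 1 := by
      rw [hc, one_div, ← Real.exp_neg, Real.log_exp]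
      norm_num
    rw [h1, Real.log_mul (by positivity) (by positivity), Real.log_mul (by positivity)
      (by positivity), h2]
    linarith [Real.log_le_sub_one_of_pos (by norm_num : (0 : ℝ) < 7)]
  obtain ⟨m, hm, hlearn⟩ := learnable_of_ternary_card_le (family := mhrPriors)
    (target := fun D => (1 - ε) * optRevenue D) (Δ := Δ) (w := max Δ (ε / 7 * c))
    (c := c) (κ := ε / 7) (A := 8) (T := T) hc0 hc1 (by positivity)
    (by linarith) (le_max_right _ _) (max_le hΔ1.le (by nlinarith)) (le_max_left _ _) hδ hδ1
    (by linarith) hlog (by linarith) (fun D hD => hD.1) (fun D hD => hD.2.isRegularPrior hD.1)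
    (fun D hD p hp => by
      have h7 : 1 - 7 * (ε / 7) = 1 - ε := by ring
      rw [h7] at hp
      refine mul_optRevenue_le hD.1 (by linarith) fun q h0 h1 => ?_
      rcases le_or_gt c q with h | h
      · exact hp q ⟨h, h1⟩
      · exact (mul_le_mul_of_nonneg_left (hD.2.revenue_le_of_lt hD.1 h0 h) (by linarith)).trans
          (hp c ⟨le_rfl, hc1⟩))
  refine ⟨m, hm.trans ?_, hlearn⟩
  have hX : 16 / (ε / 7) ^ 2 * min (max Δ (ε / 7 * c) / c) ((max Δ (ε / 7 * c) / c) ^ 2) ≤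
      7056 * max 1 (Δ ^ 2 / ε ^ 2) := by
    rcases le_total Δ (ε / 7 * c) with h | h
    · rw [max_eq_right h, mul_div_cancel_right₀ _ hc0.ne']
      calc _ ≤ 16 / (ε / 7) ^ 2 * (ε / 7) ^ 2 := by gcongr; exact min_le_right _ _
        _ = 16 := div_mul_cancel₀ _ (by positivity)
        _ ≤ 7056 * 1 := by norm_num
        _ ≤ _ := by gcongr; exact le_max_left _ _
    · rw [max_eq_left h]
      calc _ ≤ 16 / (ε / 7) ^ 2 * (Δ / c) ^ 2 := by gcongr; exact min_le_right _ _
        _ = 16 / (ε / 7) ^ 2 * (Δ * (1 / c)) ^ 2 := by rw [mul_one_div]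
        _ ≤ 16 / (ε / 7) ^ 2 * (Δ * 3) ^ 2 := by gcongr
        _ = 7056 * (Δ ^ 2 / ε ^ 2) := by
            field_simp
            norm_num
        _ ≤ _ := by gcongr; exact le_max_right _ _
  calc _ ≤ 51 * (2 + 3 * 8) * (577 + 5 * 8) * T ^ 2 * (7056 * max 1 (Δ ^ 2 / ε ^ 2)) := by gcongr
    _ = _ := by ring

theorem mainTheorem8 :
    (∃ (C : ℝ) (k : ℕ), ∀ ε Δ δ : ℝ, 0 < ε → ε < 1 → 0 < Δ → Δ < 1 → 0 < δ → δ < 1 →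
      ∃ m : ℕ,
        (m : ℝ) ≤ C * (1 + Real.log (1 / ε) + Real.log (1 / δ)) ^ k *
          max 1 (min (Δ ^ 2 / ε ^ 4) (Δ / ε ^ 3)) ∧
        Learnable regularPriors (fun D => (1 - ε) * optRevenue D) Δ δ m) ∧
    (∃ (C : ℝ) (k : ℕ), ∀ ε Δ δ : ℝ, 0 < ε → ε < 1 → 0 < Δ → Δ < 1 → 0 < δ → δ < 1 →
      ∃ m : ℕ,
        (m : ℝ) ≤ C * (1 + Real.log (1 / ε) + Real.log (1 / δ)) ^ k *
          max 1 (Δ ^ 2 / ε ^ 2) ∧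
        Learnable mhrPriors (fun D => (1 - ε) * optRevenue D) Δ δ m) ∧
    (∃ (C : ℝ) (k : ℕ), ∀ H ε Δ δ : ℝ, 1 ≤ H → 0 < ε → ε < 1 → 0 < Δ → Δ < 1 → 0 < δ → δ < 1 →
      ∃ m : ℕ,
        (m : ℝ) ≤ C * (1 + Real.log H + Real.log (1 / ε) + Real.log (1 / δ)) ^ k *
          max (Real.sqrt H / ε) (Δ * H / ε ^ 2) ∧
        Learnable (boundedPriors 1 H) (fun D => (1 - ε) * optRevenue D) Δ δ m) ∧
    (∃ (C : ℝ) (k : ℕ), ∀ ε Δ δ : ℝ, 0 < ε → ε < 1 → 0 < Δ → Δ < 1 → 0 < δ → δ < 1 →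
      ∃ m : ℕ,
        (m : ℝ) ≤ C * (1 + Real.log (1 / ε) + Real.log (1 / δ)) ^ k *
          max (1 / ε) (Δ / ε ^ 2) ∧
        Learnable (boundedPriors 0 1) (fun D => optRevenue D - ε) Δ δ m) := by
  exact ⟨⟨_, 2, fun _ _ _ hε hε1 hΔ hΔ1 hδ hδ1 => learnable_regularPriors hε hε1 hΔ hΔ1 hδ hδ1⟩,
    ⟨_, 2, fun _ _ _ hε hε1 hΔ hΔ1 hδ hδ1 => learnable_mhrPriors hε hε1 hΔ hΔ1 hδ hδ1⟩,
    ⟨_, 2, fun _ _ _ _ hH hε hε1 _ hΔ1 hδ hδ1 =>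
      learnable_boundedPriors_one hH hε hε1 hΔ1 hδ hδ1⟩,
    ⟨_, 1, fun _ _ _ hε hε1 _ hΔ1 hδ hδ1 => learnable_boundedPriors_zero_one hε hε1 hΔ1 hδ hδ1⟩⟩
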